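/- Let $d\ge 1$, $0\le\alpha<d$, $1<p<q<\infty$, $0<\lambda<1$, and write $p'=p/(p-1)$. Let $\varepsilon:(0,\infty)\to(0,\infty)$ be bounded below by a positive constant, decreasing on $(0,1)$, increasing on $(1,\infty)$ (monotonicity not necessarily strict), with $\sum_{r\in\mathbb Z}\varepsilon(2^r)^{-1}<\infty$. Then there is a constant $C<\infty$, depending only on $d,\alpha,p,q,\lambda,\varepsilon$, such that the following holds. Let $\mathcal S$ be a $\lambda$-sparse collection of dyadic cubes in $\mathbb R^d$; that is, $\mathcal S$ consists of half-open axis-parallel cubes whose side lengths are integer powers of $2$, any two of which are nested or disjoint (for instance, a subcollection of a dyadic grid), and for every $Q_0\in\mathcal S$ the maximal cubes $Q\in\mathcal S$ with $Q\subsetneq Q_0$ satisfy $\sum_{Q}|Q|\le\lambda|Q_0|$. Let $\sigma,w$ be weights, i.e. nonnegative locally integrable functions on $\mathbb R^d$, and put $w(Q)=\int_Q w$, $\sigma(Q)=\int_Q\sigma$, $\langle f\rangle_Q=|Q|^{-1}\int_Q f$, and $$T_{\alpha,\mathcal S}f=\sum_{Q\in\mathcal S}|Q|^{\alpha/d}\langle|f|\rangle_Q\mathbf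 1_Q .$$ Then $$\|T_{\alpha,\mathcal S}(\sigma\,\cdot):L^p(\sigma)\to L^q(w)\|\le C(\mathcal D+\mathcal D_*),$$ where, with suprema over all axis-parallel cubes $Q\subset\mathbb R^d$, $$\mathcal D=\sup_Q\frac{w(Q)^{1/q}\sigma(Q)^{1/p'}}{|Q|^{1-\alpha/d}}\,\varepsilon(\langle\sigma\rangle_Q)^{1/q},\qquad \mathcal D_*=\sup_Q\frac{w(Q)^{1/q}\sigma(Q)^{1/p'}}{|Q|^{1-\alpha/d}}\,\varepsilon(\langle w\rangle_Q)^{1/p'}$$ (a term with $\sigma(Q)=0$ or $w(Q)=0$ is read as $0$). -/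

import Mathlib

open MeasureTheory Set
open scoped ENNReal NNReal

namespace SparseBump

noncomputable section

/-- A half-open axis-parallel cube in `ℝ^d` of side length `l`. -/
def IsCubeOfSide {d : ℕ} (l : ℝ) (Q : Set (Fin d → ℝ)) : Prop :=
  0 < l ∧ ∃ a : Fin d → ℝ, Q = Set.univ.pi fun i => Set.Ico (a i) (a i + l)

/-- A half-open axis-parallel cube in `ℝ^d`. -/
def IsCube {d : ℕ} (Q : Set (Fin d → ℝ)) : Prop :=
  ∃ l : ℝ, IsCubeOfSide l Q

/-- A collection of dyadic cubes: the side lengths are integer powers of two, and any two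
cubes are nested or disjoint. Every subcollection of a dyadic grid is of this kind. -/
def IsDyadicFamily {d : ℕ} (S : Set (Set (Fin d → ℝ))) : Prop :=
  (∀ Q ∈ S, ∃ k : ℤ, IsCubeOfSide ((2 : ℝ) ^ k) Q) ∧
    ∀ Q ∈ S, ∀ R ∈ S, Q ⊆ R ∨ R ⊆ Q ∨ Disjoint Q R

/-- The maximal cubes of `S` among those strictly contained in `Q₀`. -/
def maximalSubcubes {d : ℕ} (S : Set (Set (Fin d → ℝ))) (Q₀ : Set (Fin d → ℝ)) :
    Set (Set (Fin d → ℝ)) :=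
  {Q | Maximal (fun R => R ∈ S ∧ R ⊂ Q₀) Q}

/-- `S` is a `lam`-sparse collection of dyadic cubes: the maximal proper subcubes in `S` of any
`Q₀ ∈ S` have total volume at most `lam |Q₀|`. -/
def IsSparse {d : ℕ} (lam : ℝ) (S : Set (Set (Fin d → ℝ))) : Prop :=
  IsDyadicFamily S ∧
    ∀ Q₀ ∈ S, ∑' Q : maximalSubcubes S Q₀, volume (Q : Set (Fin d → ℝ)) ≤
      ENNReal.ofReal lam * volume Q₀

/-- A weight: a nonnegative locally integrable function. -/
def IsWeight {d : ℕ} (u : (Fin d → ℝ) → ℝ) : Prop :=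
  LocallyIntegrable u volume ∧ ∀ᵐ x, 0 ≤ u x

/-- The measure `u(x) dx`, so that `weightMeasure u Q` is `u(Q)`. -/
def weightMeasure {d : ℕ} (u : (Fin d → ℝ) → ℝ) : Measure (Fin d → ℝ) :=
  volume.withDensity fun x => ENNReal.ofReal (u x)

/-- The sparse operator `T f = ∑_{Q ∈ S} |Q|^{α/d} ⟨|f|⟩_Q 1_Q`, with values in `[0, ∞]`. -/
def sparseOp {d : ℕ} (α : ℝ) (S : Set (Set (Fin d → ℝ))) (f : (Fin d → ℝ) → ℝ)
    (x : Fin d → ℝ) : ℝ≥0∞ :=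
  ∑' Q : S, (Q : Set (Fin d → ℝ)).indicator
    (fun _ => volume (Q : Set (Fin d → ℝ)) ^ (α / d) *
      ((∫⁻ y in (Q : Set (Fin d → ℝ)), ‖f y‖ₑ) / volume (Q : Set (Fin d → ℝ)))) x

/-- The norm of `f ↦ T(σ f)` from `L^p(σ)` to `L^q(w)`, as an element of `[0, ∞]`. -/
def sparseOpNorm {d : ℕ} (α p q : ℝ) (S : Set (Set (Fin d → ℝ)))
    (σ w : (Fin d → ℝ) → ℝ) : ℝ≥0∞ :=
  ⨆ (f : (Fin d → ℝ) → ℝ) (_ : MemLp f (ENNReal.ofReal p) (weightMeasure σ))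
    (_ : eLpNorm f (ENNReal.ofReal p) (weightMeasure σ) ≤ 1),
    eLpNorm (sparseOp α S fun x => σ x * f x) (ENNReal.ofReal q) (weightMeasure w)

/-- `w(Q)^{1/q} σ(Q)^{1/p'} / |Q|^{1 - α/d}`. -/
def apq {d : ℕ} (α p q : ℝ) (σ w : (Fin d → ℝ) → ℝ) (Q : Set (Fin d → ℝ)) : ℝ≥0∞ :=
  weightMeasure w Q ^ (1 / q) * weightMeasure σ Q ^ (1 / p.conjExponent) /
    volume Q ^ (1 - α / d)

/-- The direct comparison bump constant with bump `ε(⟨σ⟩_Q)^{1/q}`. -/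
def bumpD {d : ℕ} (α p q : ℝ) (ε : ℝ → ℝ) (σ w : (Fin d → ℝ) → ℝ) : ℝ≥0∞ :=
  ⨆ (Q : Set (Fin d → ℝ)) (_ : IsCube Q),
    apq α p q σ w Q * ENNReal.ofReal (ε (⨍ x in Q, σ x)) ^ (1 / q)

/-- The dual direct comparison bump constant with bump `ε(⟨w⟩_Q)^{1/p'}`. -/
def bumpDStar {d : ℕ} (α p q : ℝ) (ε : ℝ → ℝ) (σ w : (Fin d → ℝ) → ℝ) : ℝ≥0∞ :=
  ⨆ (Q : Set (Fin d → ℝ)) (_ : IsCube Q),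
    apq α p q σ w Q * ENNReal.ofReal (ε (⨍ x in Q, w x)) ^ (1 / p.conjExponent)

/-- `ε : (0,∞) → (0,∞)` is bounded away from zero, decreasing on `(0,1)`, increasing on
`(1,∞)`, and `∑_{r ∈ ℤ} 1/ε(2^r) < ∞`. Values of `ε` outside `(0,∞)` play no role. -/
def IsBumpFunction (ε : ℝ → ℝ) : Prop :=
  (∃ c : ℝ, 0 < c ∧ ∀ t : ℝ, 0 < t → c ≤ ε t) ∧
    AntitoneOn ε (Set.Ioo 0 1) ∧ MonotoneOn ε (Set.Ioi 1) ∧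
    Summable fun r : ℤ => (ε ((2 : ℝ) ^ r))⁻¹

end

end SparseBump

/-! By monotone convergence it is enough to bound finite subfamilies uniformly. For these, `T^q` is
integrated against `w` by pairing `T` with `g = T^(q-1)`. This leaves a positive bilinear form `∑
K_Q (∫_Q f dσ)(∫_Q g dw)` with `K_Q = |Q|^(α/d-1)`.

Since `p ≤ q`, the form is controlled by two Sawyer testing conditions (`bilinear_le`). Cubes are
sorted by the dyadic size of the running maximal averages of `f` and of `g`. The two corona tops of
a cube are nested, so the form splits into two symmetric halves. Each half (`half_form_le`) follows
from testing and two uses of Hölder, and the tops are summed by a discrete dyadic maximal inequality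
(`sum_tops_le`).

Testing on `R` (`exists_testing_const`) uses the strict gap `s = 1/p - 1/q > 0`. The cubes through a
point form a chain along which `K_Q` grows geometrically as the cubes shrink. Hence `∑ K_Q σ(Q)` is
at most a constant times `σ(R)^s sup K_Q σ(Q)^(1-s)` (`exists_chain_const`). With the supremum
replaced by an `ℓ^q` sum and the result integrated against `w`, the bump hypothesis turns each term
into `D^q σ(Q) / ε(⟨σ⟩_Q)`.

It remains to see that these quotients, summed over `Q ⊆ R`, are at most a constant times `σ(R)`
(`carleson_of_packing`). On cubes with `⟨σ⟩_Q ≈ 2^r`, `σ(Q)` is comparable to `2^r |Q|`, so the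
volume packing of a sparse family passes to `σ`. Each level costs about `1/ε(2^r)`, which is
summable over `r`. The other testing condition is the same statement with the weights exchanged and
dual exponents. -/

namespace SparseBump

/-! ### Corona decomposition of a finite laminar family. -/

section Corona

open scoped Classical

variable {X : Type*}

/-- Any two members of the finite family `S` are nested or disjoint. -/
def Laminar (S : Finset (Set X)) : Prop :=
  ∀ Q ∈ S, ∀ R ∈ S, Q ⊆ R ∨ R ⊆ Q ∨ Disjoint Q R

theorem Laminar.mono {S T : Finset (Set X)} (hS : Laminar S) (h : T ⊆ S) : Laminar T :=
  fun Q hQ R hR => hS Q (h hQ) R (h hR)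

theorem Laminar.nested {S : Finset (Set X)} (hS : Laminar S) {Q R : Set X} (hQ : Q ∈ S)
    (hR : R ∈ S) {x : X} (hxQ : x ∈ Q) (hxR : x ∈ R) : Q ⊆ R ∨ R ⊆ Q := by
  rcases hS Q hQ R hR with h | h | h
  · exact Or.inl h
  · exact Or.inr h
  · exact absurd hxR (Set.disjoint_left.1 h hxQ)

/-- The largest member of `S` that contains `Q` and has the same level as `Q`. -/
def levelTop (S : Finset (Set X)) (L : Set X → ℤ) (Q : Set X) : Set X :=
  ⋃₀ {R | R ∈ S ∧ Q ⊆ R ∧ L R = L Q}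

theorem subset_levelTop {S : Finset (Set X)} {L : Set X → ℤ} {Q R : Set X} (hR : R ∈ S)
    (hQR : Q ⊆ R) (hL : L R = L Q) : R ⊆ levelTop S L Q :=
  Set.subset_sUnion_of_mem ⟨hR, hQR, hL⟩

theorem self_subset_levelTop {S : Finset (Set X)} {L : Set X → ℤ} {Q : Set X} (hQ : Q ∈ S) :
    Q ⊆ levelTop S L Q :=
  subset_levelTop hQ subset_rfl rfl

/-- Members containing a common nonempty `Q` form a finite chain by laminarity, so the union
defining `levelTop` is its largest element. -/
theorem levelTop_spec {S : Finset (Set X)} (hS : Laminar S) (hne : ∀ Q ∈ S, Q.Nonempty)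
    {L : Set X → ℤ} {Q : Set X} (hQ : Q ∈ S) :
    levelTop S L Q ∈ S ∧ L (levelTop S L Q) = L Q := by
  obtain ⟨P, -, hP⟩ := Finset.exists_le_maximal (S.filter fun R => Q ⊆ R ∧ L R = L Q)
    (a := Q) (by simp [hQ])
  have hPm := Finset.mem_filter.1 hP.prop
  have key : levelTop S L Q = P := by
    apply subset_antisymm
    · rintro x ⟨R, ⟨hR, hQR, hL⟩, hx⟩
      obtain ⟨y, hy⟩ := hne Q hQ
      rcases hS.nested hR hPm.1 (hQR hy) (hPm.2.1 hy) with h | h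
      · exact h hx
      · exact hP.le_of_ge (Finset.mem_filter.2 ⟨hR, hQR, hL⟩) h hx
    · exact subset_levelTop hPm.1 hPm.2.1 hPm.2.2
  rw [key]
  exact ⟨hPm.1, hPm.2.2⟩

/-- Levels do not increase as sets grow, so they are constant between `Q` and its top. This is what
sends a top of one corona, caught between `Q` and the other top, to that other top. -/
theorem levelTop_eq_of_between {S : Finset (Set X)} (hS : Laminar S)
    (hne : ∀ Q ∈ S, Q.Nonempty) {L : Set X → ℤ}
    (hL : ∀ Q ∈ S, ∀ R ∈ S, Q ⊆ R → L R ≤ L Q) {Q R : Set X} (hQ : Q ∈ S) (hR : R ∈ S)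
    (hQR : Q ⊆ R) (hRt : R ⊆ levelTop S L Q) : levelTop S L R = levelTop S L Q := by
  obtain ⟨h1, h2⟩ := levelTop_spec hS hne (L := L) hQ
  have hLR : L R = L Q :=
    le_antisymm (hL Q hQ R hR hQR) (h2 ▸ hL R hR _ h1 hRt)
  obtain ⟨h3, h4⟩ := levelTop_spec hS hne (L := L) hR
  apply subset_antisymm
  · exact subset_levelTop h3 (hQR.trans (self_subset_levelTop hR)) (h4.trans hLR)
  · exact subset_levelTop h1 hRt (h2.trans hLR.symm)

theorem levelTop_idem {S : Finset (Set X)} (hS : Laminar S)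
    (hne : ∀ Q ∈ S, Q.Nonempty) {L : Set X → ℤ}
    (hL : ∀ Q ∈ S, ∀ R ∈ S, Q ⊆ R → L R ≤ L Q) {Q : Set X} (hQ : Q ∈ S) :
    levelTop S L (levelTop S L Q) = levelTop S L Q :=
  levelTop_eq_of_between hS hne hL hQ (levelTop_spec hS hne hQ).1 (self_subset_levelTop hQ)
    subset_rfl

/-- The members of `S` that are maximal within their level. -/
noncomputable def tops (S : Finset (Set X)) (L : Set X → ℤ) : Finset (Set X) :=
  S.filter fun Q => levelTop S L Q = Q

theorem mem_tops {S : Finset (Set X)} {L : Set X → ℤ} {Q : Set X} :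
    Q ∈ tops S L ↔ Q ∈ S ∧ levelTop S L Q = Q := by
  simp [tops]

theorem levelTop_mem_tops {S : Finset (Set X)} (hS : Laminar S)
    (hne : ∀ Q ∈ S, Q.Nonempty) {L : Set X → ℤ}
    (hL : ∀ Q ∈ S, ∀ R ∈ S, Q ⊆ R → L R ≤ L Q) {Q : Set X} (hQ : Q ∈ S) :
    levelTop S L Q ∈ tops S L :=
  mem_tops.2 ⟨(levelTop_spec hS hne hQ).1, levelTop_idem hS hne hL hQ⟩

/-- Two members of the same level that are maximal within it and meet are equal. -/
theorem tops_eq_of_mem {S : Finset (Set X)} (hS : Laminar S) {L : Set X → ℤ} {Q R : Set X}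
    (hQ : Q ∈ tops S L) (hR : R ∈ tops S L) (hLQR : L Q = L R) {x : X} (hxQ : x ∈ Q)
    (hxR : x ∈ R) : Q = R := by
  rw [mem_tops] at hQ hR
  rcases hS.nested hQ.1 hR.1 hxQ hxR with h | h
  · exact subset_antisymm h (by rw [← hQ.2]; exact subset_levelTop hR.1 h hLQR.symm)
  · exact subset_antisymm (by rw [← hR.2]; exact subset_levelTop hQ.1 h hLQR) h

theorem sum_rpow_le_rpow_sum {ι : Type*} (s : Finset ι) (f : ι → ℝ≥0∞) {a : ℝ} (ha : 1 ≤ a) :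
    ∑ i ∈ s, f i ^ a ≤ (∑ i ∈ s, f i) ^ a := by
  induction s using Finset.induction_on with
  | empty => simp
  | insert i s hi ih =>
    rw [Finset.sum_insert hi, Finset.sum_insert hi]
    exact (add_le_add le_rfl ih).trans (ENNReal.add_rpow_le_rpow_add _ _ ha)

/-- The coefficient `2 ^ L Q` as an extended nonnegative real. -/
noncomputable def levelWeight (L : Set X → ℤ) (Q : Set X) : ℝ≥0∞ := (2 : ℝ≥0∞) ^ L Q

/-- One half of the corona decomposition of a positive dyadic bilinear form: the testing condition
controls the cubes whose `w`-corona top lies in their `σ`-corona top. -/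
theorem half_form_le [MeasurableSpace X] {S : Finset (Set X)} (hS : Laminar S)
    (hne : ∀ Q ∈ S, Q.Nonempty) (hmeas : ∀ Q ∈ S, MeasurableSet Q) (σ w : Measure X)
    {p p' q r : ℝ} (hp : p.HolderConjugate p') (hq : q.HolderConjugate r) (hrp : r ≤ p')
    (K : Set X → ℝ≥0∞) (T : ℝ≥0∞)
    (hT : ∀ R ∈ S, (∫⁻ x, (∑ Q ∈ S.filter (· ⊆ R),
      Q.indicator (fun _ => K Q * σ Q) x) ^ q ∂w) ^ (1 / q) ≤ T * σ R ^ (1 / p))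
    {L N : Set X → ℤ} (hL : ∀ Q ∈ S, ∀ R ∈ S, Q ⊆ R → L R ≤ L Q)
    (hN : ∀ Q ∈ S, ∀ R ∈ S, Q ⊆ R → N R ≤ N Q) :
    ∑ Q ∈ S.filter (fun Q => levelTop S N Q ⊆ levelTop S L Q),
        K Q * σ Q * w Q * levelWeight L Q * levelWeight N Q ≤
      T * (∑ F ∈ tops S L, levelWeight L F ^ p * σ F) ^ (1 / p) *
        (∑ G ∈ tops S N, levelWeight N G ^ r * w G) ^ (1 / r) := by
  have hr0 : 0 < r := hq.symm.pos
  set H : Set X → ℝ≥0∞ := fun F =>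
    ∑ G ∈ (tops S N).filter (fun G => levelTop S L G = F), levelWeight N G ^ r * w G with hH
  set B := S.filter (fun Q => levelTop S N Q ⊆ levelTop S L Q) with hB
  have hBS : ∀ Q ∈ B, Q ∈ S := fun Q hQ => (Finset.mem_filter.1 hQ).1
  have hfib : ∀ F ∈ tops S L, ∑ Q ∈ B with levelTop S L Q = F,
      K Q * σ Q * w Q * levelWeight L Q * levelWeight N Q ≤
        levelWeight L F * (T * σ F ^ (1 / p) * H F ^ (1 / r)) := by
    intro F hF
    have hFS := (mem_tops.1 hF).1
    -- An `ℓ^r` sum over the `N`-tops attached to `F`: it dominates `2 ^ N Q` on each relevant `Q`,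
    -- while `∫ h^r dw` is exactly additive over the tops.
    set h : X → ℝ≥0∞ := fun x =>
      (∑ G ∈ (tops S N).filter (fun G => levelTop S L G = F),
        G.indicator (fun _ => levelWeight N G ^ r) x) ^ (1 / r) with hh
    set t : X → ℝ≥0∞ := fun x => ∑ Q ∈ S.filter (· ⊆ F),
      Q.indicator (fun _ => K Q * σ Q) x with ht
    have htm : Measurable t := by
      apply Finset.measurable_sum
      intro Q hQ
      exact measurable_const.indicator (hmeas Q (Finset.mem_filter.1 hQ).1)
    have hhm : Measurable h := by
      apply Measurable.pow_const
      apply Finset.measurable_sum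
      intro Q hQ
      exact measurable_const.indicator
        (hmeas Q (mem_tops.1 (Finset.mem_filter.1 hQ).1).1)
    have hhint : ∫⁻ x, h x ^ r ∂w = H F := by
      have : ∀ x, h x ^ r = ∑ G ∈ (tops S N).filter (fun G => levelTop S L G = F),
          G.indicator (fun _ => levelWeight N G ^ r) x := by
        intro x
        rw [hh]
        simp only
        rw [← ENNReal.rpow_mul, one_div_mul_cancel hr0.ne', ENNReal.rpow_one]
      simp_rw [this]
      rw [lintegral_finsetSum]
      · apply Finset.sum_congr rfl
        intro G hG
        rw [lintegral_indicator_const (hmeas G (mem_tops.1 (Finset.mem_filter.1 hG).1).1)]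
      · intro G hG
        exact measurable_const.indicator (hmeas G (mem_tops.1 (Finset.mem_filter.1 hG).1).1)
    -- The `N`-top of `Q` lies between `Q` and `F`, hence is itself attached to `F` and occurs in
    -- the sum defining `h`.
    have hlow : ∀ Q ∈ B, levelTop S L Q = F → ∀ x ∈ Q, levelWeight N Q ≤ h x := by
      intro Q hQ hQF x hx
      have hQB := Finset.mem_filter.1 hQ
      have hGS := levelTop_spec hS hne (L := N) hQB.1
      have hmem : levelTop S N Q ∈ (tops S N).filter (fun G => levelTop S L G = F) := by
        refine Finset.mem_filter.2 ⟨levelTop_mem_tops hS hne hN hQB.1, ?_⟩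
        rw [← hQF]
        exact levelTop_eq_of_between hS hne hL hQB.1 hGS.1 (self_subset_levelTop hQB.1) hQB.2
      have hx' : x ∈ levelTop S N Q := self_subset_levelTop hQB.1 hx
      have h1 : levelWeight N Q ^ r ≤ ∑ G ∈ (tops S N).filter (fun G => levelTop S L G = F),
          G.indicator (fun _ => levelWeight N G ^ r) x := by
        refine le_trans ?_ (Finset.single_le_sum (fun _ _ => zero_le) hmem)
        rw [Set.indicator_of_mem hx', levelWeight, levelWeight, hGS.2]
      calc levelWeight N Q = (levelWeight N Q ^ r) ^ (1 / r) := by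
            rw [← ENNReal.rpow_mul, mul_one_div_cancel hr0.ne', ENNReal.rpow_one]
        _ ≤ h x := ENNReal.rpow_le_rpow h1 (by positivity)
    calc ∑ Q ∈ B with levelTop S L Q = F, K Q * σ Q * w Q * levelWeight L Q * levelWeight N Q
        = ∑ Q ∈ B with levelTop S L Q = F,
            levelWeight L F * ∫⁻ x, Q.indicator (fun _ => K Q * σ Q * levelWeight N Q) x ∂w := by
          apply Finset.sum_congr rfl
          intro Q hQ
          obtain ⟨hQ1, hQ2⟩ := Finset.mem_filter.1 hQ
          rw [lintegral_indicator_const (hmeas Q (hBS Q hQ1))]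
          have : levelWeight L F = levelWeight L Q := by
            rw [levelWeight, levelWeight, ← hQ2, (levelTop_spec hS hne (L := L) (hBS Q hQ1)).2]
          rw [this]; ring
      _ = levelWeight L F * ∫⁻ x, ∑ Q ∈ B with levelTop S L Q = F,
            Q.indicator (fun _ => K Q * σ Q * levelWeight N Q) x ∂w := by
          rw [← Finset.mul_sum, lintegral_finsetSum]
          intro Q hQ
          exact measurable_const.indicator (hmeas Q (hBS Q (Finset.mem_filter.1 hQ).1))
      _ ≤ levelWeight L F * ∫⁻ x, (t * h) x ∂w := by
          gcongr with x
          rw [Pi.mul_apply, ht]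
          simp only
          rw [Finset.sum_mul]
          refine le_trans (Finset.sum_le_sum (g := fun Q =>
            Q.indicator (fun _ => K Q * σ Q) x * h x) ?_) ?_
          · intro Q hQ
            obtain ⟨hQ1, hQ2⟩ := Finset.mem_filter.1 hQ
            by_cases hx : x ∈ Q
            · rw [Set.indicator_of_mem hx, Set.indicator_of_mem hx]
              gcongr
              exact hlow Q hQ1 hQ2 x hx
            · simp [hx]
          · apply Finset.sum_le_sum_of_subset
            intro Q hQ
            obtain ⟨hQ1, hQ2⟩ := Finset.mem_filter.1 hQ
            refine Finset.mem_filter.2 ⟨hBS Q hQ1, ?_⟩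
            rw [← hQ2]
            exact self_subset_levelTop (hBS Q hQ1)
      _ ≤ levelWeight L F * ((∫⁻ x, t x ^ q ∂w) ^ (1 / q) * (∫⁻ x, h x ^ r ∂w) ^ (1 / r)) := by
          gcongr
          exact ENNReal.lintegral_mul_le_Lp_mul_Lq w hq htm.aemeasurable hhm.aemeasurable
      _ ≤ levelWeight L F * (T * σ F ^ (1 / p) * H F ^ (1 / r)) := by
          rw [hhint]
          gcongr
          exact hT F hFS
  have hHsum : ∑ F ∈ tops S L, H F = ∑ G ∈ tops S N, levelWeight N G ^ r * w G :=
    Finset.sum_fiberwise_of_maps_to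
      (fun G hG => levelTop_mem_tops hS hne hL (mem_tops.1 hG).1) _
  calc ∑ Q ∈ B, K Q * σ Q * w Q * levelWeight L Q * levelWeight N Q
      = ∑ F ∈ tops S L, ∑ Q ∈ B with levelTop S L Q = F,
          K Q * σ Q * w Q * levelWeight L Q * levelWeight N Q :=
        (Finset.sum_fiberwise_of_maps_to
          (fun Q hQ => levelTop_mem_tops hS hne hL (hBS Q hQ)) _).symm
    _ ≤ ∑ F ∈ tops S L, levelWeight L F * (T * σ F ^ (1 / p) * H F ^ (1 / r)) :=
        Finset.sum_le_sum hfib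
    _ = T * ∑ F ∈ tops S L, (levelWeight L F * σ F ^ (1 / p)) * H F ^ (1 / r) := by
        rw [Finset.mul_sum]
        exact Finset.sum_congr rfl fun F _ => by ring
    _ ≤ T * ((∑ F ∈ tops S L, (levelWeight L F * σ F ^ (1 / p)) ^ p) ^ (1 / p) *
          (∑ F ∈ tops S L, (H F ^ (1 / r)) ^ p') ^ (1 / p')) := by
        gcongr
        exact ENNReal.inner_le_Lp_mul_Lq _ _ _ hp
    _ ≤ T * ((∑ F ∈ tops S L, levelWeight L F ^ p * σ F) ^ (1 / p) *
          (∑ G ∈ tops S N, levelWeight N G ^ r * w G) ^ (1 / r)) := by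
        have hp0 := hp.pos
        have hp0' := hp.symm.pos
        gcongr T * (?_ * ?_)
        · refine ENNReal.rpow_le_rpow (Finset.sum_le_sum fun F _ => ?_) (by positivity)
          rw [ENNReal.mul_rpow_of_nonneg _ _ hp0.le, ← ENNReal.rpow_mul,
            one_div_mul_cancel hp0.ne', ENNReal.rpow_one]
        · rw [← hHsum]
          calc (∑ F ∈ tops S L, (H F ^ (1 / r)) ^ p') ^ (1 / p')
              = (∑ F ∈ tops S L, H F ^ (p' / r)) ^ (1 / p') := by
                simp_rw [← ENNReal.rpow_mul]
                congr 1
                exact Finset.sum_congr rfl fun F _ => by congr 1; ring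
            _ ≤ ((∑ F ∈ tops S L, H F) ^ (p' / r)) ^ (1 / p') := by
                refine ENNReal.rpow_le_rpow ?_ (by positivity)
                -- The condition `r ≤ p'`, dual to `p ≤ q`, makes the exponent `p' / r` at least
                -- one; this is the embedding of `ℓ^1` into `ℓ^(p'/r)`.
                exact sum_rpow_le_rpow_sum _ _ ((one_le_div hr0).2 hrp)
            _ = (∑ F ∈ tops S L, H F) ^ (1 / r) := by
                rw [← ENNReal.rpow_mul]
                congr 1
                field_simp
    _ = _ := by ring

end Corona

/-! ### Discrete maximal inequality and the two-weight testing theorem. -/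

section Bilinear

open scoped Classical

variable {X : Type*}

/-- Distinct powers of two are dominated by a geometric series starting at the largest one, which is
at most `y`. -/
theorem sum_two_zpow_rpow_le (s : Finset ℤ) {a : ℝ} (ha : 0 < a) {y : ℝ≥0∞}
    (hy : ∀ k ∈ s, (2 : ℝ≥0∞) ^ k ≤ y) :
    ∑ k ∈ s, ((2 : ℝ≥0∞) ^ k) ^ a ≤ (1 - (2 : ℝ≥0∞) ^ (-a))⁻¹ * y ^ a := by
  rcases s.eq_empty_or_nonempty with rfl | hs
  · simp
  set n := s.max' hs
  have hterm : ∀ k ∈ s, ((2 : ℝ≥0∞) ^ k) ^ a ≤ y ^ a * ((2 : ℝ≥0∞) ^ (-a)) ^ (n - k).toNat := by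
    intro k hk
    have hkn : k ≤ n := s.le_max' k hk
    have h1 : ((2 : ℝ≥0∞) ^ k) ^ a = ((2 : ℝ≥0∞) ^ n) ^ a * ((2 : ℝ≥0∞) ^ (-a)) ^ (n - k).toNat := by
      rw [← ENNReal.rpow_intCast, ← ENNReal.rpow_intCast, ← ENNReal.rpow_natCast,
        ← ENNReal.rpow_mul, ← ENNReal.rpow_mul, ← ENNReal.rpow_mul,
        ← ENNReal.rpow_add _ _ two_ne_zero (by simp)]
      congr 1
      have : (((n - k).toNat : ℕ) : ℝ) = (n : ℝ) - k := by
        rw [← Int.cast_natCast, Int.toNat_of_nonneg (by omega)]; push_cast; ring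
      rw [this]; ring
    rw [h1]
    gcongr
    exact hy n (s.max'_mem hs)
  calc ∑ k ∈ s, ((2 : ℝ≥0∞) ^ k) ^ a
      ≤ ∑ k ∈ s, y ^ a * ((2 : ℝ≥0∞) ^ (-a)) ^ (n - k).toNat := Finset.sum_le_sum hterm
    _ = y ^ a * ∑ j ∈ s.image (fun k => (n - k).toNat), ((2 : ℝ≥0∞) ^ (-a)) ^ j := by
        rw [← Finset.mul_sum, Finset.sum_image]
        intro i hi j hj hij
        have h1 := s.le_max' i hi
        have h2 := s.le_max' j hj
        simp only at hij
        omega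
    _ ≤ y ^ a * ∑' j : ℕ, ((2 : ℝ≥0∞) ^ (-a)) ^ j := by
        gcongr
        exact ENNReal.sum_le_tsum _
    _ = _ := by rw [ENNReal.tsum_geometric, mul_comm]

/-- The running maximum of `ℓ` over the members of `S` that contain `Q`. -/
noncomputable def maxLevel (S : Finset (Set X)) (ℓ : Set X → ℤ) (Q : Set X) : ℤ :=
  if h : (S.filter (Q ⊆ ·)).Nonempty then (S.filter (Q ⊆ ·)).sup' h ℓ else 0

theorem le_maxLevel {S : Finset (Set X)} {ℓ : Set X → ℤ} {Q R : Set X} (hR : R ∈ S)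
    (hQR : Q ⊆ R) : ℓ R ≤ maxLevel S ℓ Q := by
  have hm : R ∈ S.filter (Q ⊆ ·) := Finset.mem_filter.2 ⟨hR, hQR⟩
  rw [maxLevel, dif_pos ⟨R, hm⟩]
  exact Finset.le_sup' ℓ hm

theorem exists_maxLevel_eq {S : Finset (Set X)} {ℓ : Set X → ℤ} {Q : Set X} (hQ : Q ∈ S) :
    ∃ R ∈ S, Q ⊆ R ∧ maxLevel S ℓ Q = ℓ R := by
  have hm : (S.filter (Q ⊆ ·)).Nonempty := ⟨Q, Finset.mem_filter.2 ⟨hQ, subset_rfl⟩⟩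
  obtain ⟨R, hR, h⟩ := Finset.exists_mem_eq_sup' hm ℓ
  rw [Finset.mem_filter] at hR
  exact ⟨R, hR.1, hR.2, by rw [maxLevel, dif_pos hm, h]⟩

theorem maxLevel_anti {S : Finset (Set X)} {ℓ : Set X → ℤ} :
    ∀ Q ∈ S, ∀ R ∈ S, Q ⊆ R → maxLevel S ℓ R ≤ maxLevel S ℓ Q := by
  intro Q _ R hR hQR
  obtain ⟨P, hP, hRP, h⟩ := exists_maxLevel_eq (ℓ := ℓ) hR
  rw [h]
  exact le_maxLevel hP (hQR.trans hRP)

/-- At a top of a level, the running maximum is attained. -/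
theorem maxLevel_eq_of_mem_tops {S : Finset (Set X)} {ℓ : Set X → ℤ} {F : Set X}
    (hF : F ∈ tops S (maxLevel S ℓ)) : maxLevel S ℓ F = ℓ F := by
  rw [mem_tops] at hF
  obtain ⟨R, hR, hFR, h⟩ := exists_maxLevel_eq (ℓ := ℓ) hF.1
  have h1 : maxLevel S ℓ R = maxLevel S ℓ F :=
    le_antisymm (maxLevel_anti F hF.1 R hR hFR) (h ▸ le_maxLevel hR subset_rfl)
  have h2 : R ⊆ F := by
    conv_rhs => rw [← hF.2]
    exact subset_levelTop hR hFR h1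
  rw [h, subset_antisymm h2 hFR]

/-- The constant of the discrete dyadic maximal inequality. -/
noncomputable def maxConst (p : ℝ) : ℝ≥0∞ :=
  2 * ((1 - (2 : ℝ≥0∞) ^ (-(p - 1)))⁻¹ * 2 ^ (p - 1))

theorem maxConst_ne_top {p : ℝ} (hp : 1 < p) : maxConst p ≠ ∞ := by
  have h : (2 : ℝ≥0∞) ^ (-(p - 1)) < 1 := by
    rw [ENNReal.rpow_neg, ENNReal.inv_lt_one]
    exact ENNReal.one_lt_rpow (by norm_num) (by linarith)
  refine ENNReal.mul_ne_top (by simp) (ENNReal.mul_ne_top ?_ ?_)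
  · rw [Ne, ENNReal.inv_eq_top, tsub_eq_zero_iff_le, not_le]
    exact h
  · exact ENNReal.rpow_ne_top_of_nonneg (by linarith) (by simp)

/-- A discrete form of the `L^p` bound for the dyadic maximal function. -/
theorem sum_tops_le [MeasurableSpace X] {S : Finset (Set X)} (hS : Laminar S)
    (hmeas : ∀ Q ∈ S, MeasurableSet Q)
    (σ : Measure X) (hσ : ∀ Q ∈ S, σ Q ≠ ∞) {p : ℝ} (hp : 1 < p) {f : X → ℝ≥0∞}
    (hf : Measurable f) {ℓ : Set X → ℤ}
    (hℓ : ∀ Q ∈ S, (2 : ℝ≥0∞) ^ ℓ Q * σ Q ≤ ∫⁻ x in Q, f x ∂σ) :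
    ∑ F ∈ tops S (maxLevel S ℓ), levelWeight (maxLevel S ℓ) F ^ p * σ F ≤
      maxConst p * ∫⁻ x, f x ^ p ∂σ := by
  set L := maxLevel S ℓ with hLdef
  -- Where `f` is at most half of `2 ^ L F`, it contributes at most half of `2 ^ L F * σ F`. So `E
  -- F` carries at least half of that quantity, and there `f` controls the level.
  set E : Set X → Set X := fun F => F ∩ {x | (2 : ℝ≥0∞) ^ L F < 2 * f x} with hE
  have hEm : ∀ F ∈ tops S L, MeasurableSet (E F) := fun F hF =>
    (hmeas F (mem_tops.1 hF).1).inter (measurableSet_lt measurable_const (hf.const_mul 2))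
  have hterm : ∀ F ∈ tops S L, levelWeight L F ^ p * σ F ≤
      ∫⁻ x, (E F).indicator (fun x => 2 * levelWeight L F ^ (p - 1) * f x) x ∂σ := by
    intro F hF
    have hFS := (mem_tops.1 hF).1
    have hk0 : levelWeight L F ≠ 0 := (ENNReal.zpow_pos (by simp) (by simp) _).ne'
    have hkt : levelWeight L F ≠ ∞ := (ENNReal.zpow_lt_top (by simp) (by simp) _).ne
    set I := ∫⁻ x in E F, f x ∂σ with hI
    have h1 : levelWeight L F * σ F ≤ ∫⁻ x in F, f x ∂σ := by
      have := hℓ F hFS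
      rwa [← maxLevel_eq_of_mem_tops hF] at this
    have h2 : ∫⁻ x in F, f x ∂σ ≤ I + levelWeight L F / 2 * σ F := by
      have hsub : ∫⁻ x in F \ E F, f x ∂σ ≤ levelWeight L F / 2 * σ F := by
        calc ∫⁻ x in F \ E F, f x ∂σ ≤ ∫⁻ x in F \ E F, levelWeight L F / 2 ∂σ := by
              refine setLIntegral_mono measurable_const fun x hx => ?_
              have hx' : ¬ ((2 : ℝ≥0∞) ^ L F < 2 * f x) := fun h => hx.2 ⟨hx.1, h⟩
              rw [ENNReal.le_div_iff_mul_le (by simp) (by simp), mul_comm]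
              exact not_lt.1 hx'
          _ = levelWeight L F / 2 * σ (F \ E F) := by simp
          _ ≤ _ := by gcongr; exact sdiff_subset
      calc ∫⁻ x in F, f x ∂σ = I + ∫⁻ x in F \ E F, f x ∂σ := by
            have := lintegral_inter_add_sdiff (μ := σ) f F
              (measurableSet_lt measurable_const (hf.const_mul 2) :
                MeasurableSet {x | (2 : ℝ≥0∞) ^ L F < 2 * f x})
            rw [← this, hI, hE]
            simp
        _ ≤ _ := by gcongr
    have h3 : levelWeight L F / 2 * σ F ≤ I := by
      have hfin : levelWeight L F / 2 * σ F ≠ ∞ :=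
        ENNReal.mul_ne_top (ENNReal.div_ne_top hkt (by simp)) (hσ F hFS)
      refine (ENNReal.add_le_add_iff_right hfin).1 ?_
      rw [← add_mul, ENNReal.add_halves]
      exact h1.trans h2
    have h4 : levelWeight L F * σ F ≤ 2 * I := by
      calc levelWeight L F * σ F = 2 * (levelWeight L F / 2 * σ F) := by
            rw [← mul_assoc, ENNReal.mul_div_cancel (by simp) (by simp)]
        _ ≤ _ := by gcongr
    rw [lintegral_indicator (hEm F hF), lintegral_const_mul _ hf]
    calc levelWeight L F ^ p * σ F
        = levelWeight L F ^ (p - 1) * (levelWeight L F * σ F) := by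
          rw [← mul_assoc]
          congr 1
          conv_lhs => rw [show p = (p - 1) + 1 by ring, ENNReal.rpow_add _ _ hk0 hkt,
            ENNReal.rpow_one]
      _ ≤ levelWeight L F ^ (p - 1) * (2 * I) := by gcongr
      _ = _ := by ring
  have hpoint : ∀ x, ∑ F ∈ tops S L,
      (E F).indicator (fun x => 2 * levelWeight L F ^ (p - 1) * f x) x ≤
        maxConst p * f x ^ p := by
    intro x
    rcases eq_or_ne (f x) 0 with hfx | hfx
    · rw [Finset.sum_eq_zero]
      · simp
      · intro F _
        simp [Set.indicator, hfx]
    rcases eq_or_ne (f x) ∞ with hft | hft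
    · rw [hft, ENNReal.top_rpow_of_pos (by linarith), ENNReal.mul_top]
      · exact le_top
      · simp [maxConst, ENNReal.rpow_eq_zero_iff]
    have hsum : ∑ F ∈ tops S L,
        (E F).indicator (fun x => 2 * levelWeight L F ^ (p - 1) * f x) x =
          ∑ F ∈ (tops S L).filter (x ∈ E ·), 2 * levelWeight L F ^ (p - 1) * f x := by
      rw [Finset.sum_filter]
      exact Finset.sum_congr rfl fun F _ => by simp [Set.indicator]
    -- Tops through `x` have distinct levels, so their weights sum as distinct powers of two below
    -- `2 * f x`.
    have hinj : Set.InjOn L ((tops S L).filter (x ∈ E ·) : Finset (Set X)) := by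
      intro F hF G hG hFG
      rw [Finset.mem_coe, Finset.mem_filter] at hF hG
      exact tops_eq_of_mem hS hF.1 hG.1 hFG hF.2.1 hG.2.1
    rw [hsum, ← Finset.sum_mul, ← Finset.mul_sum]
    have hgeo : ∑ F ∈ (tops S L).filter (x ∈ E ·), levelWeight L F ^ (p - 1) ≤
        (1 - (2 : ℝ≥0∞) ^ (-(p - 1)))⁻¹ * (2 * f x) ^ (p - 1) := by
      have : ∑ F ∈ (tops S L).filter (x ∈ E ·), levelWeight L F ^ (p - 1) =
          ∑ k ∈ ((tops S L).filter (x ∈ E ·)).image L, ((2 : ℝ≥0∞) ^ k) ^ (p - 1) := by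
        rw [Finset.sum_image hinj]
        rfl
      rw [this]
      refine sum_two_zpow_rpow_le _ (by linarith) fun k hk => ?_
      obtain ⟨F, hF, rfl⟩ := Finset.mem_image.1 hk
      exact (Finset.mem_filter.1 hF).2.2.le
    calc 2 * (∑ F ∈ (tops S L).filter (x ∈ E ·), levelWeight L F ^ (p - 1)) * f x
        ≤ 2 * ((1 - (2 : ℝ≥0∞) ^ (-(p - 1)))⁻¹ * (2 * f x) ^ (p - 1)) * f x := by
          gcongr
      _ = maxConst p * f x ^ p := by
          rw [ENNReal.mul_rpow_of_nonneg _ _ (by linarith), maxConst]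
          conv_rhs => rw [show p = (p - 1) + 1 by ring, ENNReal.rpow_add _ _ hfx hft,
            ENNReal.rpow_one, add_sub_cancel_right]
          ring
  calc ∑ F ∈ tops S L, levelWeight L F ^ p * σ F
      ≤ ∑ F ∈ tops S L, ∫⁻ x, (E F).indicator
          (fun x => 2 * levelWeight L F ^ (p - 1) * f x) x ∂σ := Finset.sum_le_sum hterm
    _ = ∫⁻ x, ∑ F ∈ tops S L, (E F).indicator
          (fun x => 2 * levelWeight L F ^ (p - 1) * f x) x ∂σ := by
        rw [lintegral_finsetSum]
        intro F hF
        exact (hf.const_mul _).indicator (hEm F hF)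
    _ ≤ ∫⁻ x, maxConst p * f x ^ p ∂σ := lintegral_mono hpoint
    _ = _ := lintegral_const_mul _ (hf.pow_const _)

/-- The level is the integer part of the base-two logarithm of the `σ`-average of `f`. Nonzero
finite integrals are needed for it to exist. -/
theorem exists_average_level [MeasurableSpace X] (S : Finset (Set X)) (σ : Measure X)
    (hσ : ∀ Q ∈ S, σ Q ≠ ∞) (f : X → ℝ≥0∞)
    (h0 : ∀ Q ∈ S, ∫⁻ x in Q, f x ∂σ ≠ 0) (ht : ∀ Q ∈ S, ∫⁻ x in Q, f x ∂σ ≠ ∞) :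
    ∃ ℓ : Set X → ℤ, ∀ Q ∈ S, (2 : ℝ≥0∞) ^ ℓ Q * σ Q ≤ ∫⁻ x in Q, f x ∂σ ∧
      ∫⁻ x in Q, f x ∂σ ≤ 2 * (2 : ℝ≥0∞) ^ ℓ Q * σ Q := by
  have : ∀ Q, ∃ n : ℤ, Q ∈ S → (2 : ℝ≥0∞) ^ n * σ Q ≤ ∫⁻ x in Q, f x ∂σ ∧
      ∫⁻ x in Q, f x ∂σ ≤ 2 * (2 : ℝ≥0∞) ^ n * σ Q := by
    intro Q
    by_cases hQ : Q ∈ S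
    · have hσ0 : σ Q ≠ 0 := fun h => h0 Q hQ (setLIntegral_measure_zero _ _ h)
      obtain ⟨n, hn1, hn2⟩ := ENNReal.exists_mem_Ico_zpow (y := 2)
        (ENNReal.div_ne_zero.2 ⟨h0 Q hQ, hσ Q hQ⟩) (ENNReal.div_ne_top (ht Q hQ) hσ0)
        (by norm_num) (by simp)
      refine ⟨n, fun _ => ⟨?_, ?_⟩⟩
      · exact (ENNReal.le_div_iff_mul_le (Or.inl hσ0) (Or.inl (hσ Q hQ))).1 hn1
      · rw [← ENNReal.div_le_iff hσ0 (hσ Q hQ)]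
        refine hn2.le.trans_eq ?_
        rw [ENNReal.zpow_add (by simp) (by simp), zpow_one, mul_comm]
    · exact ⟨0, fun h => absurd h hQ⟩
  choose ℓ hℓ using this
  exact ⟨ℓ, hℓ⟩

/-- Both testing conditions together bound a positive dyadic bilinear form. -/
theorem bilinear_le [MeasurableSpace X] {S : Finset (Set X)} (hS : Laminar S)
    (hne : ∀ Q ∈ S, Q.Nonempty) (hmeas : ∀ Q ∈ S, MeasurableSet Q) (σ w : Measure X)
    (hσ : ∀ Q ∈ S, σ Q ≠ ∞) (hw : ∀ Q ∈ S, w Q ≠ ∞)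
    {p p' q r : ℝ} (hp : p.HolderConjugate p') (hq : q.HolderConjugate r) (hpq : p ≤ q)
    (hrp : r ≤ p') (K : Set X → ℝ≥0∞) (T : ℝ≥0∞)
    (hT : ∀ R ∈ S, (∫⁻ x, (∑ Q ∈ S.filter (· ⊆ R),
      Q.indicator (fun _ => K Q * σ Q) x) ^ q ∂w) ^ (1 / q) ≤ T * σ R ^ (1 / p))
    (T' : ℝ≥0∞)
    (hT' : ∀ R ∈ S, (∫⁻ x, (∑ Q ∈ S.filter (· ⊆ R),
      Q.indicator (fun _ => K Q * w Q) x) ^ p' ∂σ) ^ (1 / p') ≤ T' * w R ^ (1 / r))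
    {f g : X → ℝ≥0∞} (hf : Measurable f) (hg : Measurable g)
    (hf0 : ∀ Q ∈ S, ∫⁻ x in Q, f x ∂σ ≠ 0) (hft : ∀ Q ∈ S, ∫⁻ x in Q, f x ∂σ ≠ ∞)
    (hg0 : ∀ Q ∈ S, ∫⁻ x in Q, g x ∂w ≠ 0) (hgt : ∀ Q ∈ S, ∫⁻ x in Q, g x ∂w ≠ ∞) :
    ∑ Q ∈ S, K Q * (∫⁻ x in Q, f x ∂σ) * (∫⁻ x in Q, g x ∂w) ≤
      4 * (T + T') * (maxConst p * ∫⁻ x, f x ^ p ∂σ) ^ (1 / p) *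
        (maxConst r * ∫⁻ x, g x ^ r ∂w) ^ (1 / r) := by
  obtain ⟨ℓ, hℓ⟩ := exists_average_level S σ hσ f hf0 hft
  obtain ⟨m, hm⟩ := exists_average_level S w hw g hg0 hgt
  set L := maxLevel S ℓ
  set N := maxLevel S m
  have hL := maxLevel_anti (S := S) (ℓ := ℓ)
  have hN := maxLevel_anti (S := S) (ℓ := m)
  have hp0 := hp.pos
  have hr0 := hq.symm.pos
  set a := (maxConst p * ∫⁻ x, f x ^ p ∂σ) ^ (1 / p) with ha
  set b := (maxConst r * ∫⁻ x, g x ^ r ∂w) ^ (1 / r) with hb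
  have hA : (∑ F ∈ tops S L, levelWeight L F ^ p * σ F) ^ (1 / p) ≤ a :=
    ENNReal.rpow_le_rpow (sum_tops_le hS hmeas σ hσ hp.lt hf fun Q hQ => (hℓ Q hQ).1)
      (by positivity)
  have hB : (∑ F ∈ tops S N, levelWeight N F ^ r * w F) ^ (1 / r) ≤ b :=
    ENNReal.rpow_le_rpow (sum_tops_le hS hmeas w hw hq.symm.lt hg fun Q hQ => (hm Q hQ).1)
      (by positivity)
  have h1 := half_form_le hS hne hmeas σ w hp hq hrp K T hT hL hN
  have h2 := half_form_le hS hne hmeas w σ hq.symm hp.symm hpq K T' hT' hN hL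
  -- Both tops of `Q` contain `Q`, so they are nested one way or the other. Cubes with equal tops
  -- are counted twice, which is harmless.
  have hcover : ∑ Q ∈ S, K Q * σ Q * w Q * levelWeight L Q * levelWeight N Q ≤
      (∑ Q ∈ S.filter (fun Q => levelTop S N Q ⊆ levelTop S L Q),
        K Q * σ Q * w Q * levelWeight L Q * levelWeight N Q) +
      ∑ Q ∈ S.filter (fun Q => levelTop S L Q ⊆ levelTop S N Q),
        K Q * w Q * σ Q * levelWeight N Q * levelWeight L Q := by
    rw [← Finset.sum_filter_add_sum_filter_not S
      (fun Q => levelTop S N Q ⊆ levelTop S L Q)]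
    gcongr
    refine le_trans (Finset.sum_le_sum_of_subset (t := S.filter
      (fun Q => levelTop S L Q ⊆ levelTop S N Q)) ?_) (Finset.sum_le_sum fun Q _ => ?_)
    · intro Q hQ
      obtain ⟨hQS, hn⟩ := Finset.mem_filter.1 hQ
      refine Finset.mem_filter.2 ⟨hQS, ?_⟩
      obtain ⟨x, hx⟩ := hne Q hQS
      exact (hS.nested (levelTop_spec hS hne (L := N) hQS).1
        (levelTop_spec hS hne (L := L) hQS).1 (self_subset_levelTop hQS hx)
        (self_subset_levelTop hQS hx)).resolve_left hn
    · exact le_of_eq (by ring)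
  calc ∑ Q ∈ S, K Q * (∫⁻ x in Q, f x ∂σ) * (∫⁻ x in Q, g x ∂w)
      ≤ ∑ Q ∈ S, K Q * (2 * levelWeight L Q * σ Q) * (2 * levelWeight N Q * w Q) := by
        refine Finset.sum_le_sum fun Q hQ => ?_
        gcongr
        · refine (hℓ Q hQ).2.trans ?_
          rw [levelWeight]
          gcongr
          · norm_num
          · exact le_maxLevel hQ subset_rfl
        · refine (hm Q hQ).2.trans ?_
          rw [levelWeight]
          gcongr
          · norm_num
          · exact le_maxLevel hQ subset_rfl
    _ = 4 * ∑ Q ∈ S, K Q * σ Q * w Q * levelWeight L Q * levelWeight N Q := by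
        rw [Finset.mul_sum]
        exact Finset.sum_congr rfl fun Q _ => by ring
    _ ≤ 4 * (T * a * b + T' * b * a) := by
        gcongr
        refine hcover.trans (add_le_add (h1.trans ?_) (h2.trans ?_))
        · gcongr
        · gcongr
    _ = _ := by ring

end Bilinear

/-! ### Testing conditions from a bumped bound and a Carleson condition. -/

section Testing

open scoped Classical

variable {X : Type*}

/-- Along a finite chain on which `K` grows geometrically as the sets shrink and `u` is monotone,
a bound `K u ≤ M u ^ s` on each term bounds the whole sum. -/
theorem exists_chain_const (X : Type*) {ρ s : ℝ} (hρ : 1 < ρ) (hs : 0 < s) :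
    ∃ C : ℝ, 0 < C ∧ ∀ (c : Finset (Set X)) (u K : Set X → ℝ) (U M : ℝ),
      (∀ Q ∈ c, ∀ R ∈ c, Q ⊆ R ∨ R ⊆ Q) → (∀ Q ∈ c, 0 < u Q) → (∀ Q ∈ c, 0 < K Q) →
      (∀ Q ∈ c, ∀ R ∈ c, Q ⊂ R → ρ * K R ≤ K Q ∧ u Q ≤ u R) → (∀ Q ∈ c, u Q ≤ U) →
      0 ≤ U → 0 ≤ M →
      (∀ Q ∈ c, K Q * u Q ≤ M * u Q ^ s) → ∑ Q ∈ c, K Q * u Q ≤ C * (M * U ^ s) := by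
  -- Any `κ` strictly between `1 / ρ` and `1` would serve. `B` and `A` are then chosen so that `B κ
  -- ρ = B + 1` and `A (1 - κ^s) = 1 + B`, the identities that close the induction.
  set κ : ℝ := 2 / (1 + ρ) with hκ
  have hκ0 : 0 < κ := by positivity
  have hκ1 : κ < 1 := by rw [hκ, div_lt_one (by linarith)]; linarith
  have hκρ : 0 < κ * ρ - 1 := by
    have : κ * ρ - 1 = (ρ - 1) / (1 + ρ) := by rw [hκ]; field_simp; ring
    rw [this]
    exact div_pos (by linarith) (by linarith)
  set B : ℝ := 1 / (κ * ρ - 1) with hB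
  have hB0 : 0 < B := by positivity
  have hBeq : B * (κ * ρ) = B + 1 := by rw [hB]; field_simp; ring
  have hκs : 0 < 1 - κ ^ s := sub_pos.2 (Real.rpow_lt_one hκ0.le hκ1 hs)
  set A : ℝ := (1 + B) / (1 - κ ^ s) with hA
  have hA0 : 0 < A := by positivity
  have hAeq : A * (1 - κ ^ s) = 1 + B := by rw [hA]; field_simp
  refine ⟨A + B + 1, by positivity, fun c u K U M => ?_⟩
  intro hchain hu hK hKu hU hU0 hM hb
  -- A potential argument: sets are added in order of increasing `K`, that is, from large to small,
  -- and `P` is the last one added. The unspent potential `A * (M * u P ^ s)` pays for later terms.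
  have main : ∀ c' : Finset (Set X), c' ⊆ c → c' = ∅ ∨ ∃ P ∈ c',
      ∑ Q ∈ c', K Q * u Q + A * (M * u P ^ s) ≤ A * (M * U ^ s) + (B + 1) * (K P * u P) := by
    intro c'
    induction c' using Finset.induction_on_max_value K with
    | empty => exact fun _ => Or.inl rfl
    | insert a t hat hmax ih =>
      intro hsub
      right
      have hac : a ∈ c := hsub (Finset.mem_insert_self a t)
      have htc : t ⊆ c := fun Q hQ => hsub (Finset.mem_insert_of_mem hQ)
      refine ⟨a, Finset.mem_insert_self a t, ?_⟩
      rw [Finset.sum_insert hat]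
      have hua := hu a hac
      have hca : 0 < K a * u a := mul_pos (hK a hac) hua
      rcases ih htc with rfl | ⟨P, hPt, hP⟩
      · have h1 : u a ^ s ≤ U ^ s := Real.rpow_le_rpow hua.le (hU a hac) hs.le
        have h2 : A * (M * u a ^ s) ≤ A * (M * U ^ s) := by gcongr
        have h3 : 0 ≤ B * (K a * u a) := by positivity
        simp only [Finset.sum_empty]
        linarith
      · have hPc := htc hPt
        have huP := hu P hPc
        have hKP := hK P hPc
        have haP : a ⊂ P := by
          have hne : a ≠ P := fun h => hat (h ▸ hPt)
          rcases hchain a hac P hPc with h | h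
          · exact LE.le.ssubset_of_ne h hne
          · exfalso
            have h1 := (hKu P hPc a hac (LE.le.ssubset_of_ne h hne.symm)).1
            have h2 := hmax P hPt
            have h3 := hK a hac
            nlinarith
        obtain ⟨hKaP, huaP⟩ := hKu a hac P hPc haP
        have hstep : (B + 1) * (K P * u P) ≤
            A * (M * u P ^ s) - A * (M * u a ^ s) + B * (K a * u a) := by
          -- If `u` drops by the factor `κ`, the drop in potential pays for `(B + 1) * (K P * u P)`.
          -- Otherwise `K * u` grows by at least `κ * ρ > 1`, and the new term absorbs the old one.
          rcases le_total (u a) (κ * u P) with h | h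
          · have h1 : u a ^ s ≤ κ ^ s * u P ^ s := by
              rw [← Real.mul_rpow hκ0.le huP.le]
              exact Real.rpow_le_rpow hua.le h hs.le
            have h2 : A * (M * u a ^ s) ≤ A * (M * (κ ^ s * u P ^ s)) := by gcongr
            have h3 : A * (M * u P ^ s) - A * (M * (κ ^ s * u P ^ s)) =
                (1 + B) * (M * u P ^ s) := by rw [← hAeq]; ring
            have h4 : (1 + B) * (K P * u P) ≤ (1 + B) * (M * u P ^ s) := by
              gcongr ?_ * ?_
              exact hb P hPc
            have h5 : 0 ≤ B * (K a * u a) := by positivity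
            linarith
          · have h1 : (ρ * K P) * (κ * u P) ≤ K a * u a := by
              have := (hK a hac).le
              gcongr
            have h2 : B * ((ρ * K P) * (κ * u P)) ≤ B * (K a * u a) := by gcongr
            have h3 : B * ((ρ * K P) * (κ * u P)) = (B + 1) * (K P * u P) := by
              rw [← hBeq]; ring
            have h4 : u a ^ s ≤ u P ^ s := Real.rpow_le_rpow hua.le huaP hs.le
            have h5 : A * (M * u a ^ s) ≤ A * (M * u P ^ s) := by gcongr
            linarith
        linarith
  have hUs : 0 ≤ U ^ s := Real.rpow_nonneg hU0 s
  rcases main c subset_rfl with rfl | ⟨P, hPc, hP⟩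
  · simp only [Finset.sum_empty]
    positivity
  · have huP := hu P hPc
    have h1 : u P ^ s ≤ U ^ s := Real.rpow_le_rpow huP.le (hU P hPc) hs.le
    have h2 : K P * u P ≤ M * U ^ s := (hb P hPc).trans (by gcongr)
    have h3 : (B + 1) * (K P * u P) ≤ (B + 1) * (M * U ^ s) := by gcongr
    have h4 : 0 ≤ A * (M * u P ^ s) := by positivity
    linarith

/-- The pointwise consequence of `exists_chain_const` for sums of `K Q * σ Q` over the members
of a chain contained in `R`. -/
theorem chain_rpow_le [MeasurableSpace X] {ρ s C q : ℝ} (hq : 0 < q) (hC : 0 < C) (hs : 0 < s)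
    (hchainC : ∀ (c : Finset (Set X)) (u K : Set X → ℝ) (U M : ℝ),
      (∀ Q ∈ c, ∀ R ∈ c, Q ⊆ R ∨ R ⊆ Q) → (∀ Q ∈ c, 0 < u Q) → (∀ Q ∈ c, 0 < K Q) →
      (∀ Q ∈ c, ∀ R ∈ c, Q ⊂ R → ρ * K R ≤ K Q ∧ u Q ≤ u R) → (∀ Q ∈ c, u Q ≤ U) →
      0 ≤ U → 0 ≤ M →
      (∀ Q ∈ c, K Q * u Q ≤ M * u Q ^ s) → ∑ Q ∈ c, K Q * u Q ≤ C * (M * U ^ s))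
    (hρ : 0 ≤ ρ) (c : Finset (Set X)) (hc : ∀ Q ∈ c, ∀ R ∈ c, Q ⊆ R ∨ R ⊆ Q)
    (σ : Measure X) (hσ0 : ∀ Q ∈ c, σ Q ≠ 0)
    (K : Set X → ℝ≥0∞) (hK0 : ∀ Q ∈ c, K Q ≠ 0) (hKt : ∀ Q ∈ c, K Q ≠ ∞)
    (hK : ∀ Q ∈ c, ∀ R ∈ c, Q ⊂ R → ENNReal.ofReal ρ * K R ≤ K Q)
    {R : Set X} (hR : ∀ Q ∈ c, Q ⊆ R) (hσR : σ R ≠ ∞) :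
    (∑ Q ∈ c, K Q * σ Q) ^ q ≤
      ENNReal.ofReal C ^ q * σ R ^ (s * q) * ∑ Q ∈ c, K Q ^ q * σ Q ^ ((1 - s) * q) := by
  set u : Set X → ℝ := fun Q => (σ Q).toReal with hu
  set k : Set X → ℝ := fun Q => (K Q).toReal with hk
  have hσt : ∀ Q ∈ c, σ Q ≠ ∞ := fun Q hQ => ne_top_of_le_ne_top hσR (measure_mono (hR Q hQ))
  have hupos : ∀ Q ∈ c, 0 < u Q := fun Q hQ => ENNReal.toReal_pos (hσ0 Q hQ) (hσt Q hQ)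
  have hkpos : ∀ Q ∈ c, 0 < k Q := fun Q hQ => ENNReal.toReal_pos (hK0 Q hQ) (hKt Q hQ)
  have hue : ∀ Q ∈ c, σ Q = ENNReal.ofReal (u Q) := fun Q hQ =>
    (ENNReal.ofReal_toReal (hσt Q hQ)).symm
  have hke : ∀ Q ∈ c, K Q = ENNReal.ofReal (k Q) := fun Q hQ =>
    (ENNReal.ofReal_toReal (hKt Q hQ)).symm
  have hUe : σ R = ENNReal.ofReal (u R) := (ENNReal.ofReal_toReal hσR).symm
  set Z : ℝ := ∑ Q ∈ c, k Q ^ q * u Q ^ ((1 - s) * q) with hZ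
  have hZterm : ∀ Q ∈ c, 0 ≤ k Q ^ q * u Q ^ ((1 - s) * q) := fun Q hQ =>
    mul_nonneg (Real.rpow_nonneg (hkpos Q hQ).le _) (Real.rpow_nonneg (hupos Q hQ).le _)
  have hZ0 : 0 ≤ Z := Finset.sum_nonneg hZterm
  -- The bound `M` is the `ℓ^q` norm of the numbers `k Q * u Q ^ (1 - s)`, which dominates each of
  -- them. Unlike their supremum, its `q`-th power is a sum that can be integrated term by term.
  have hreal : ∑ Q ∈ c, k Q * u Q ≤ C * (Z ^ (1 / q) * u R ^ s) := by
    refine hchainC c u k (u R) (Z ^ (1 / q)) hc hupos hkpos ?_ ?_ ENNReal.toReal_nonneg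
      (Real.rpow_nonneg hZ0 _) ?_
    · intro Q hQ P hP hQP
      refine ⟨?_, ENNReal.toReal_mono (hσt P hP) (measure_mono hQP.subset)⟩
      have := ENNReal.toReal_mono (hKt Q hQ) (hK Q hQ P hP hQP)
      rwa [ENNReal.toReal_mul, ENNReal.toReal_ofReal hρ] at this
    · exact fun Q hQ => ENNReal.toReal_mono hσR (measure_mono (hR Q hQ))
    · intro Q hQ
      have h1 : k Q * u Q ^ (1 - s) ≤ Z ^ (1 / q) := by
        have h2 : (k Q * u Q ^ (1 - s)) ^ q ≤ Z := by
          rw [Real.mul_rpow (hkpos Q hQ).le (Real.rpow_nonneg (hupos Q hQ).le _),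
            ← Real.rpow_mul (hupos Q hQ).le]
          exact Finset.single_le_sum (f := fun Q => k Q ^ q * u Q ^ ((1 - s) * q)) hZterm hQ
        have h3 := Real.rpow_le_rpow (Real.rpow_nonneg (mul_nonneg (hkpos Q hQ).le
          (Real.rpow_nonneg (hupos Q hQ).le _)) _) h2 (by positivity : 0 ≤ 1 / q)
        rwa [← Real.rpow_mul (mul_nonneg (hkpos Q hQ).le
          (Real.rpow_nonneg (hupos Q hQ).le _)), mul_one_div_cancel hq.ne', Real.rpow_one] at h3
      calc k Q * u Q = k Q * u Q ^ (1 - s) * u Q ^ s := by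
            rw [mul_assoc, ← Real.rpow_add (hupos Q hQ), sub_add_cancel, Real.rpow_one]
        _ ≤ _ := by
            have := Real.rpow_nonneg (hupos Q hQ).le s
            gcongr
  have huR : 0 ≤ u R := ENNReal.toReal_nonneg
  have hS0 : 0 ≤ ∑ Q ∈ c, k Q * u Q :=
    Finset.sum_nonneg fun Q hQ => (mul_pos (hkpos Q hQ) (hupos Q hQ)).le
  have hpow : (∑ Q ∈ c, k Q * u Q) ^ q ≤ C ^ q * u R ^ (s * q) * Z := by
    refine (Real.rpow_le_rpow hS0 hreal hq.le).trans_eq ?_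
    rw [Real.mul_rpow hC.le (by positivity), Real.mul_rpow (by positivity) (by positivity),
      ← Real.rpow_mul hZ0, one_div_mul_cancel hq.ne', Real.rpow_one, ← Real.rpow_mul huR]
    ring
  have e1 : ∑ Q ∈ c, K Q * σ Q = ENNReal.ofReal (∑ Q ∈ c, k Q * u Q) := by
    rw [ENNReal.ofReal_sum_of_nonneg fun Q hQ => (mul_pos (hkpos Q hQ) (hupos Q hQ)).le]
    refine Finset.sum_congr rfl fun Q hQ => ?_
    rw [ENNReal.ofReal_mul (hkpos Q hQ).le, ← hue Q hQ, ← hke Q hQ]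
  have e2 : ∑ Q ∈ c, K Q ^ q * σ Q ^ ((1 - s) * q) = ENNReal.ofReal Z := by
    rw [hZ, ENNReal.ofReal_sum_of_nonneg hZterm]
    refine Finset.sum_congr rfl fun Q hQ => ?_
    rw [ENNReal.ofReal_mul (Real.rpow_nonneg (hkpos Q hQ).le _),
      ← ENNReal.ofReal_rpow_of_pos (hkpos Q hQ), ← ENNReal.ofReal_rpow_of_pos (hupos Q hQ),
      ← hue Q hQ, ← hke Q hQ]
  rw [e1, e2, hUe, ENNReal.ofReal_rpow_of_nonneg hS0 hq.le,
    ENNReal.ofReal_rpow_of_pos hC, ENNReal.ofReal_rpow_of_nonneg huR (by positivity),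
    ← ENNReal.ofReal_mul (by positivity), ← ENNReal.ofReal_mul (by positivity)]
  exact ENNReal.ofReal_le_ofReal hpow

/-- The testing condition: a bumped `A_{p,q}` bound together with the Carleson property of the
reciprocal bumps. -/
theorem exists_testing_const (X : Type*) [MeasurableSpace X] {ρ p p' q : ℝ} (hρ : 1 < ρ)
    (hp : p.HolderConjugate p') (hpq : p < q) :
    ∃ C : ℝ≥0, ∀ (S : Finset (Set X)), Laminar S → (∀ Q ∈ S, MeasurableSet Q) →
      ∀ (σ w : Measure X), (∀ Q ∈ S, σ Q ≠ 0) → (∀ Q ∈ S, σ Q ≠ ∞) →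
      ∀ K : Set X → ℝ≥0∞, (∀ Q ∈ S, K Q ≠ 0) → (∀ Q ∈ S, K Q ≠ ∞) →
      (∀ Q ∈ S, ∀ R ∈ S, Q ⊂ R → ENNReal.ofReal ρ * K R ≤ K Q) →
      ∀ (e : Set X → ℝ≥0∞) (D Γ : ℝ≥0∞), (∀ Q ∈ S, e Q ≠ 0) → (∀ Q ∈ S, e Q ≠ ∞) →
      (∀ Q ∈ S, K Q * w Q ^ (1 / q) * σ Q ^ (1 / p') * e Q ^ (1 / q) ≤ D) →
      (∀ R ∈ S, ∑ Q ∈ S.filter (· ⊆ R), σ Q / e Q ≤ Γ * σ R) →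
      ∀ R ∈ S, (∫⁻ x, (∑ Q ∈ S.filter (· ⊆ R),
        Q.indicator (fun _ => K Q * σ Q) x) ^ q ∂w) ^ (1 / q) ≤
          C * Γ ^ (1 / q) * D * σ R ^ (1 / p) := by
  have hp0 := hp.pos
  have hq0 : 0 < q := hp0.trans hpq
  have hs : 0 < 1 / p - 1 / q := sub_pos.2 (one_div_lt_one_div_of_lt hp0 hpq)
  set s := 1 / p - 1 / q with hsdef
  obtain ⟨C, hC, hchain⟩ := exists_chain_const X hρ hs
  refine ⟨C.toNNReal, ?_⟩
  intro S hS hmeas σ w hσ0 hσt K hK0 hKt hKρ e D Γ he0 het hD hΓ R hR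
  -- The exponents leave exactly one spare power of `σ Q` beyond those in the `q`-th power of the
  -- bumped bound. The Carleson sum returns `σ R`, completing `σ R ^ (q / p)`.
  have hsq : s * q = q / p - 1 := by rw [hsdef]; field_simp
  have h1s : (1 - s) * q = q / p' + 1 := by
    have h := hp.inv_add_inv_eq_one
    rw [sub_mul, hsq, one_mul, div_eq_mul_inv, div_eq_mul_inv]
    linear_combination (-q) * h
  have hpt : ∀ x, (∑ Q ∈ S.filter (· ⊆ R), Q.indicator (fun _ => K Q * σ Q) x) ^ q ≤
      ENNReal.ofReal C ^ q * σ R ^ (s * q) * ∑ Q ∈ S.filter (· ⊆ R),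
        Q.indicator (fun _ => K Q ^ q * σ Q ^ ((1 - s) * q)) x := by
    intro x
    have hconv : ∀ φ : Set X → ℝ≥0∞, ∑ Q ∈ S.filter (· ⊆ R), Q.indicator (fun _ => φ Q) x =
        ∑ Q ∈ (S.filter (· ⊆ R)).filter (x ∈ ·), φ Q := by
      intro φ
      rw [Finset.sum_filter (s := S.filter (· ⊆ R))]
      exact Finset.sum_congr rfl fun Q _ => by simp [Set.indicator]
    rw [hconv (fun Q => K Q * σ Q), hconv (fun Q => K Q ^ q * σ Q ^ ((1 - s) * q))]
    have hmem : ∀ Q ∈ (S.filter (· ⊆ R)).filter (x ∈ ·), Q ∈ S ∧ Q ⊆ R ∧ x ∈ Q := by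
      intro Q hQ
      simp only [Finset.mem_filter] at hQ
      exact ⟨hQ.1.1, hQ.1.2, hQ.2⟩
    exact chain_rpow_le hq0 hC hs hchain (by linarith) _
      (fun Q hQ P hP => hS.nested (hmem Q hQ).1 (hmem P hP).1 (hmem Q hQ).2.2 (hmem P hP).2.2)
      σ (fun Q hQ => hσ0 Q (hmem Q hQ).1) K (fun Q hQ => hK0 Q (hmem Q hQ).1)
      (fun Q hQ => hKt Q (hmem Q hQ).1)
      (fun Q hQ P hP => hKρ Q (hmem Q hQ).1 P (hmem P hP).1)
      (fun Q hQ => (hmem Q hQ).2.1) (hσt R hR)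
  have hterm : ∀ Q ∈ S, K Q ^ q * σ Q ^ ((1 - s) * q) * w Q ≤ D ^ q * (σ Q / e Q) := by
    intro Q hQ
    have h1 := ENNReal.rpow_le_rpow (hD Q hQ) hq0.le
    rw [ENNReal.mul_rpow_of_nonneg _ _ hq0.le, ENNReal.mul_rpow_of_nonneg _ _ hq0.le,
      ENNReal.mul_rpow_of_nonneg _ _ hq0.le, ← ENNReal.rpow_mul, ← ENNReal.rpow_mul,
      ← ENNReal.rpow_mul, one_div_mul_cancel hq0.ne', ENNReal.rpow_one, ENNReal.rpow_one,
      one_div_mul_eq_div] at h1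
    rw [h1s, ENNReal.rpow_add _ _ (hσ0 Q hQ) (hσt Q hQ), ENNReal.rpow_one]
    calc K Q ^ q * (σ Q ^ (q / p') * σ Q) * w Q
        = K Q ^ q * w Q * σ Q ^ (q / p') * (e Q * (e Q)⁻¹) * σ Q := by
          rw [ENNReal.mul_inv_cancel (he0 Q hQ) (het Q hQ)]; ring
      _ = (K Q ^ q * w Q * σ Q ^ (q / p') * e Q) * (σ Q / e Q) := by
          rw [div_eq_mul_inv (σ Q)]; ring
      _ ≤ _ := by gcongr
  have hint : ∫⁻ x, (∑ Q ∈ S.filter (· ⊆ R), Q.indicator (fun _ => K Q * σ Q) x) ^ q ∂w ≤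
      ENNReal.ofReal C ^ q * Γ * D ^ q * σ R ^ (q / p) := by
    have hm : ∀ Q ∈ S.filter (· ⊆ R),
        Measurable (Q.indicator (fun _ => K Q ^ q * σ Q ^ ((1 - s) * q))) := fun Q hQ =>
      measurable_const.indicator (hmeas Q (Finset.mem_filter.1 hQ).1)
    calc _ ≤ ∫⁻ x, ENNReal.ofReal C ^ q * σ R ^ (s * q) * ∑ Q ∈ S.filter (· ⊆ R),
            Q.indicator (fun _ => K Q ^ q * σ Q ^ ((1 - s) * q)) x ∂w := lintegral_mono hpt
      _ = ENNReal.ofReal C ^ q * σ R ^ (s * q) *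
            ∑ Q ∈ S.filter (· ⊆ R), K Q ^ q * σ Q ^ ((1 - s) * q) * w Q := by
          rw [lintegral_const_mul _ (Finset.measurable_sum _ hm), lintegral_finsetSum _ hm]
          congr 1
          exact Finset.sum_congr rfl fun Q hQ =>
            lintegral_indicator_const (hmeas Q (Finset.mem_filter.1 hQ).1) _
      _ ≤ ENNReal.ofReal C ^ q * σ R ^ (s * q) *
            ∑ Q ∈ S.filter (· ⊆ R), D ^ q * (σ Q / e Q) := by
          gcongr _ * ?_
          refine Finset.sum_le_sum fun Q hQ => ?_
          exact hterm Q (Finset.mem_filter.1 hQ).1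
      _ ≤ ENNReal.ofReal C ^ q * σ R ^ (s * q) * (D ^ q * (Γ * σ R)) := by
          rw [← Finset.mul_sum]
          gcongr
          exact hΓ R hR
      _ = ENNReal.ofReal C ^ q * Γ * D ^ q * (σ R ^ (s * q) * σ R) := by ring
      _ = _ := by
          congr 1
          conv_rhs => rw [show q / p = s * q + 1 by rw [hsq]; ring,
            ENNReal.rpow_add _ _ (hσ0 R hR) (hσt R hR), ENNReal.rpow_one]
  refine (ENNReal.rpow_le_rpow hint (by positivity : 0 ≤ 1 / q)).trans_eq ?_
  have h0 : 0 ≤ 1 / q := by positivity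
  rw [ENNReal.mul_rpow_of_nonneg _ _ h0, ENNReal.mul_rpow_of_nonneg _ _ h0,
    ENNReal.mul_rpow_of_nonneg _ _ h0, ← ENNReal.rpow_mul, ← ENNReal.rpow_mul,
    ← ENNReal.rpow_mul, mul_one_div_cancel hq0.ne', ENNReal.rpow_one, ENNReal.rpow_one,
    show q / p * (1 / q) = 1 / p by field_simp]
  rfl

end Testing

/-! ### Geometry of dyadic cubes and the packing property of sparse families. -/

section Cubes

variable {d : ℕ}

theorem IsCubeOfSide.nonempty {l : ℝ} {Q : Set (Fin d → ℝ)} (h : IsCubeOfSide l Q) :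
    Q.Nonempty := by
  obtain ⟨hl, a, rfl⟩ := h
  exact ⟨a, fun i _ => ⟨le_rfl, by linarith⟩⟩

theorem IsCubeOfSide.measurableSet {l : ℝ} {Q : Set (Fin d → ℝ)} (h : IsCubeOfSide l Q) :
    MeasurableSet Q := by
  obtain ⟨hl, a, rfl⟩ := h
  exact MeasurableSet.univ_pi fun i => measurableSet_Ico

theorem IsCubeOfSide.volume_eq {l : ℝ} {Q : Set (Fin d → ℝ)} (h : IsCubeOfSide l Q) :
    volume Q = ENNReal.ofReal l ^ d := by
  obtain ⟨hl, a, rfl⟩ := h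
  rw [Real.volume_pi_Ico]
  simp

theorem IsCubeOfSide.volume_ne_zero {l : ℝ} {Q : Set (Fin d → ℝ)} (h : IsCubeOfSide l Q) :
    volume Q ≠ 0 := by
  rw [h.volume_eq]
  exact pow_ne_zero _ (ENNReal.ofReal_pos.2 h.1).ne'

theorem IsCubeOfSide.volume_ne_top {l : ℝ} {Q : Set (Fin d → ℝ)} (h : IsCubeOfSide l Q) :
    volume Q ≠ ∞ := by
  rw [h.volume_eq]
  exact ENNReal.pow_ne_top ENNReal.ofReal_ne_top

theorem IsCubeOfSide.interior_nonempty {l : ℝ} {Q : Set (Fin d → ℝ)} (h : IsCubeOfSide l Q) :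
    (interior Q).Nonempty := by
  obtain ⟨hl, a, rfl⟩ := h
  rw [interior_pi_set Set.finite_univ]
  refine ⟨fun i => a i + l / 2, fun i _ => ?_⟩
  simp only [interior_Ico]
  constructor <;> linarith

theorem IsCubeOfSide.subset_isCompact {l : ℝ} {Q : Set (Fin d → ℝ)} (h : IsCubeOfSide l Q) :
    ∃ T, IsCompact T ∧ Q ⊆ T := by
  obtain ⟨hl, a, rfl⟩ := h
  exact ⟨Set.univ.pi fun i => Set.Icc (a i) (a i + l), isCompact_univ_pi fun i => isCompact_Icc,
    Set.pi_mono fun i _ => Set.Ico_subset_Icc_self⟩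

theorem IsCubeOfSide.side_le (hd : 0 < d) {l m : ℝ} {Q R : Set (Fin d → ℝ)}
    (hQ : IsCubeOfSide l Q) (hR : IsCubeOfSide m R) (h : Q ⊆ R) : l ≤ m := by
  have := measure_mono (μ := volume) h
  rw [hQ.volume_eq, hR.volume_eq] at this
  have h2 : ENNReal.ofReal l ≤ ENNReal.ofReal m := by
    by_contra hlt
    exact absurd this (not_le.2 (ENNReal.pow_lt_pow_left hd.ne' (not_le.1 hlt)))
  exact (ENNReal.ofReal_le_ofReal_iff hR.1.le).1 h2

theorem IsCubeOfSide.eq_of_subset {l : ℝ} {Q R : Set (Fin d → ℝ)}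
    (hQ : IsCubeOfSide l Q) (hR : IsCubeOfSide l R) (h : Q ⊆ R) : Q = R := by
  obtain ⟨hl, a, rfl⟩ := hQ
  obtain ⟨-, b, rfl⟩ := hR
  have hab : a = b := by
    rcases Set.univ_pi_subset_univ_pi_iff.1 h with h | ⟨i, hi⟩
    · funext i
      have := (Set.Ico_subset_Ico_iff (by linarith)).1 (h i)
      linarith [this.1, this.2]
    · rw [Set.Ico_eq_empty_iff] at hi
      exact absurd (by linarith) hi
  rw [hab]

theorem IsCubeOfSide.zpow_lt_of_ssubset (hd : 0 < d) {j k : ℤ} {Q R : Set (Fin d → ℝ)}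
    (hQ : IsCubeOfSide ((2 : ℝ) ^ j) Q) (hR : IsCubeOfSide ((2 : ℝ) ^ k) R) (h : Q ⊂ R) :
    j < k := by
  have h1 : j ≤ k := (zpow_le_zpow_iff_right₀ (by norm_num)).1 (hQ.side_le hd hR h.subset)
  refine lt_of_le_of_ne h1 ?_
  rintro rfl
  exact h.ne (hQ.eq_of_subset hR h.subset)

/-- Strict inclusion forces the integer exponent of the side to rise. The true factor is at least `2
^ d`; the weaker `2` already gives geometric growth of the kernel. -/
theorem two_mul_volume_le_of_ssubset (hd : 0 < d) {S : Set (Set (Fin d → ℝ))}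
    (hS : IsDyadicFamily S) {Q R : Set (Fin d → ℝ)} (hQ : Q ∈ S) (hR : R ∈ S) (h : Q ⊂ R) :
    2 * volume Q ≤ volume R := by
  obtain ⟨j, hj⟩ := hS.1 Q hQ
  obtain ⟨k, hk⟩ := hS.1 R hR
  have hjk := hj.zpow_lt_of_ssubset hd hk h
  rw [hj.volume_eq, hk.volume_eq]
  have h1 : 2 * ENNReal.ofReal ((2 : ℝ) ^ j) ≤ ENNReal.ofReal ((2 : ℝ) ^ k) := by
    rw [show (2 : ℝ≥0∞) = ENNReal.ofReal 2 by simp, ← ENNReal.ofReal_mul (by norm_num)]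
    apply ENNReal.ofReal_le_ofReal
    rw [← zpow_one_add₀ (by norm_num)]
    exact zpow_le_zpow_right₀ (by norm_num) (by omega)
  calc 2 * ENNReal.ofReal ((2 : ℝ) ^ j) ^ d ≤ 2 ^ d * ENNReal.ofReal ((2 : ℝ) ^ j) ^ d := by
        gcongr
        exact le_self_pow₀ (by norm_num) hd.ne'
    _ = (2 * ENNReal.ofReal ((2 : ℝ) ^ j)) ^ d := (mul_pow _ _ _).symm
    _ ≤ _ := by gcongr

/-- Distinct cubes of equal side are disjoint with nonempty interior, so each of the countably many
sizes occurs countably often. -/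
theorem IsDyadicFamily.countable {S : Set (Set (Fin d → ℝ))}
    (hS : IsDyadicFamily S) : S.Countable := by
  have hcov : S ⊆ ⋃ k : ℤ, {Q | Q ∈ S ∧ IsCubeOfSide ((2 : ℝ) ^ k) Q} := by
    intro Q hQ
    obtain ⟨k, hk⟩ := hS.1 Q hQ
    exact Set.mem_iUnion.2 ⟨k, hQ, hk⟩
  refine (Set.countable_iUnion fun k => ?_).mono hcov
  refine Set.PairwiseDisjoint.countable_of_nonempty_interior (s := id) ?_
    fun Q hQ => hQ.2.interior_nonempty
  intro Q hQ R hR hne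
  rcases hS.2 Q hQ.1 R hR.1 with h | h | h
  · exact absurd (hQ.2.eq_of_subset hR.2 h) hne
  · exact absurd (hR.2.eq_of_subset hQ.2 h).symm hne
  · exact h

/-- Every cube of `S` strictly inside `R` lies in a maximal one. -/
theorem exists_maximalSubcube (hd : 0 < d) {S : Set (Set (Fin d → ℝ))}
    (hS : IsDyadicFamily S) {Q R : Set (Fin d → ℝ)} (hQ : Q ∈ S) (hR : R ∈ S) (h : Q ⊂ R) :
    ∃ P ∈ maximalSubcubes S R, Q ⊆ P := by
  obtain ⟨k, hk⟩ := hS.1 R hR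
  obtain ⟨j, hj⟩ := hS.1 Q hQ
  obtain ⟨m, ⟨P, ⟨hPS, hPR, hQP⟩, hm⟩, hmax⟩ := Int.exists_greatest_of_bdd
    (P := fun m => ∃ P, (P ∈ S ∧ P ⊂ R ∧ Q ⊆ P) ∧ IsCubeOfSide ((2 : ℝ) ^ m) P)
    ⟨k, fun m ⟨P, hP, hm⟩ => (hm.zpow_lt_of_ssubset hd hk hP.2.1).le⟩
    ⟨j, Q, ⟨hQ, h, subset_rfl⟩, hj⟩
  refine ⟨P, ⟨⟨hPS, hPR⟩, ?_⟩, hQP⟩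
  rintro P' ⟨hP'S, hP'R⟩ hPP'
  obtain ⟨n, hn⟩ := hS.1 P' hP'S
  by_contra hcon
  have hlt := hm.zpow_lt_of_ssubset hd hn ⟨hPP', hcon⟩
  exact absurd (hmax n ⟨P', ⟨hP'S, hP'R, hQP.trans hPP'⟩, hn⟩) (not_le.2 hlt)

-- Induction on the number `n` of dyadic scales allowed below `R`. Apart from `R`, every cube sits
-- under a maximal proper subcube, and these have total volume at most `lam |R|`. The constant `c =
-- 1 / (1 - lam)` is the fixed point of `c = 1 + lam c`, so it is the same for all `n`.
open scoped Classical in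
theorem packing_of_generation (hd : 0 < d) {lam : ℝ} (hlam : lam < 1)
    {S : Set (Set (Fin d → ℝ))} (hS : IsSparse lam S) (n : ℕ) :
    ∀ R ∈ S, ∀ k : ℤ, IsCubeOfSide ((2 : ℝ) ^ k) R → ∀ A : Finset (Set (Fin d → ℝ)),
      (∀ Q ∈ A, Q ∈ S ∧ Q ⊆ R ∧ ∃ j : ℤ, k - n < j ∧ IsCubeOfSide ((2 : ℝ) ^ j) Q) →
      ∑ Q ∈ A, volume Q ≤ (1 - ENNReal.ofReal lam)⁻¹ * volume R := by
  have hl1 : ENNReal.ofReal lam < 1 := by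
    rw [← ENNReal.ofReal_one]; exact (ENNReal.ofReal_lt_ofReal_iff one_pos).2 hlam
  set c := (1 - ENNReal.ofReal lam)⁻¹ with hc
  have hceq : 1 + ENNReal.ofReal lam * c = c := by
    have h0 : 1 - ENNReal.ofReal lam ≠ 0 := (tsub_pos_of_lt hl1).ne'
    have ht : 1 - ENNReal.ofReal lam ≠ ∞ := ne_top_of_le_ne_top ENNReal.one_ne_top tsub_le_self
    calc 1 + ENNReal.ofReal lam * c
        = (1 - ENNReal.ofReal lam) * c + ENNReal.ofReal lam * c := by
          rw [hc, ENNReal.mul_inv_cancel h0 ht]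
      _ = c := by rw [← add_mul, tsub_add_cancel_of_le hl1.le, one_mul]
  induction n with
  | zero =>
    intro R hR k hk A hA
    have : A = ∅ := by
      rw [Finset.eq_empty_iff_forall_notMem]
      intro Q hQ
      obtain ⟨-, hQR, j, hj, hjQ⟩ := hA Q hQ
      have h1 : j ≤ k := (zpow_le_zpow_iff_right₀ (by norm_num)).1 (hjQ.side_le hd hk hQR)
      simp at hj
      omega
    simp [this]
  | succ n ih =>
    intro R hR k hk A hA
    have hsel : ∀ Q, ∃ P, Q ∈ A.erase R → P ∈ maximalSubcubes S R ∧ Q ⊆ P := by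
      intro Q
      by_cases hQ : Q ∈ A.erase R
      · obtain ⟨hne, hQA⟩ := Finset.mem_erase.1 hQ
        obtain ⟨hQS, hQR, -⟩ := hA Q hQA
        obtain ⟨P, hP, hQP⟩ := exists_maximalSubcube hd hS.1 hQS hR
          (LE.le.ssubset_of_ne hQR hne)
        exact ⟨P, fun _ => ⟨hP, hQP⟩⟩
      · exact ⟨∅, fun h => absurd h hQ⟩
    choose P hP using hsel
    have herase : ∑ Q ∈ A.erase R, volume Q ≤ ENNReal.ofReal lam * c * volume R := by
      set I := (A.erase R).image P with hI
      have hImax : ∀ T ∈ I, T ∈ maximalSubcubes S R := by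
        intro T hT
        obtain ⟨Q, hQ, rfl⟩ := Finset.mem_image.1 hT
        exact (hP Q hQ).1
      calc ∑ Q ∈ A.erase R, volume Q
          = ∑ T ∈ I, ∑ Q ∈ A.erase R with P Q = T, volume Q :=
            (Finset.sum_fiberwise_of_maps_to
              (fun Q hQ => Finset.mem_image_of_mem P hQ) _).symm
        _ ≤ ∑ T ∈ I, c * volume T := by
            refine Finset.sum_le_sum fun T hT => ?_
            obtain ⟨⟨hTS, hTR⟩, -⟩ := hImax T hT
            obtain ⟨m, hm⟩ := hS.1.1 T hTS
            have hmk := hm.zpow_lt_of_ssubset hd hk hTR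
            refine ih T hTS m hm _ fun Q hQ => ?_
            obtain ⟨hQ1, hQ2⟩ := Finset.mem_filter.1 hQ
            obtain ⟨hQS, -, j, hj, hjQ⟩ := hA Q (Finset.mem_erase.1 hQ1).2
            -- The subcube `T` has exponent `m ≤ k - 1`, so a cutoff of `n + 1` scales below `R` is
            -- at least as strict as `n` scales below `T`.
            refine ⟨hQS, hQ2 ▸ (hP Q hQ1).2, j, ?_, hjQ⟩
            push_cast at hj
            omega
        _ = c * ∑ T ∈ I, volume T := (Finset.mul_sum _ _ _).symm
        _ ≤ c * ∑' T : maximalSubcubes S R, volume (T : Set (Fin d → ℝ)) := by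
            gcongr
            rw [tsum_subtype (maximalSubcubes S R) (fun T => volume T)]
            refine le_trans (Finset.sum_le_sum fun T hT => ?_) (ENNReal.sum_le_tsum I)
            rw [Set.indicator_of_mem (hImax T hT)]
        _ ≤ c * (ENNReal.ofReal lam * volume R) := by gcongr; exact hS.2 R hR
        _ = _ := by ring
    calc ∑ Q ∈ A, volume Q ≤ ∑ Q ∈ insert R (A.erase R), volume Q :=
          Finset.sum_le_sum_of_subset (Finset.insert_erase_subset R A)
      _ = volume R + ∑ Q ∈ A.erase R, volume Q := Finset.sum_insert (Finset.notMem_erase R A)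
      _ ≤ volume R + ENNReal.ofReal lam * c * volume R := by gcongr
      _ = (1 + ENNReal.ofReal lam * c) * volume R := by ring
      _ = c * volume R := by rw [hceq]

/-- Sparse families satisfy the Carleson packing condition. -/
theorem IsSparse.packing (hd : 0 < d) {lam : ℝ} (hlam : lam < 1)
    {S : Set (Set (Fin d → ℝ))} (hS : IsSparse lam S) {R : Set (Fin d → ℝ)} (hR : R ∈ S)
    (A : Finset (Set (Fin d → ℝ))) (hA : ∀ Q ∈ A, Q ∈ S ∧ Q ⊆ R) :
    ∑ Q ∈ A, volume Q ≤ (1 - ENNReal.ofReal lam)⁻¹ * volume R := by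
  classical
  obtain ⟨k, hk⟩ := hS.1.1 R hR
  have hsel : ∀ Q, ∃ j : ℤ, Q ∈ A → IsCubeOfSide ((2 : ℝ) ^ j) Q := by
    intro Q
    by_cases hQ : Q ∈ A
    · obtain ⟨j, hj⟩ := hS.1.1 Q (hA Q hQ).1
      exact ⟨j, fun _ => hj⟩
    · exact ⟨0, fun h => absurd h hQ⟩
  choose j hj using hsel
  refine packing_of_generation hd hlam hS (A.sup fun Q => (k - j Q).toNat + 1) R hR k hk A ?_
  intro Q hQ
  refine ⟨(hA Q hQ).1, (hA Q hQ).2, j Q, ?_, hj Q hQ⟩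
  have h := Finset.le_sup (f := fun Q => (k - j Q).toNat + 1) hQ
  omega

end Cubes

/-! ### Carleson sequences from reciprocal bumps. -/

section Carleson

open scoped Classical

variable {X : Type*}

theorem sum_tops_measure_le [MeasurableSpace X] {B : Finset (Set X)} (hB : Laminar B)
    (hmeas : ∀ Q ∈ B, MeasurableSet Q) (σ : Measure X) {R : Set X} (hR : ∀ Q ∈ B, Q ⊆ R) :
    ∑ P ∈ tops B (fun _ => 0), σ P ≤ σ R := by
  have hsub : ∀ P ∈ tops B (fun _ => 0), P ∈ B := fun P hP => (mem_tops.1 hP).1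
  have hdisj : (↑(tops B (fun _ => 0)) : Set (Set X)).PairwiseDisjoint id := by
    intro P hP Q hQ hne
    refine Set.disjoint_left.2 fun x hxP hxQ => hne ?_
    exact tops_eq_of_mem hB hP hQ rfl hxP hxQ
  have := measure_biUnion_finset (μ := σ) hdisj (fun P hP => hmeas P (hsub P hP))
  simp only [id] at this
  rw [← this]
  exact measure_mono (Set.iUnion₂_subset fun P hP => hR P (hsub P hP))

/-- Reciprocal bumps that are summable over the dyadic levels of the averages of `σ` form a
Carleson sequence on a family that satisfies the packing condition with respect to `v`. -/
theorem carleson_of_packing [MeasurableSpace X] {A : Finset (Set X)} (hA : Laminar A)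
    (hne : ∀ Q ∈ A, Q.Nonempty) (hmeas : ∀ Q ∈ A, MeasurableSet Q) (σ v : Measure X)
    {c : ℝ≥0∞} (hpack : ∀ R ∈ A, ∀ B ⊆ A, (∀ Q ∈ B, Q ⊆ R) → ∑ Q ∈ B, v Q ≤ c * v R)
    {ℓ : Set X → ℤ} (hℓ : ∀ Q ∈ A, (2 : ℝ≥0∞) ^ ℓ Q * v Q ≤ σ Q ∧
      σ Q ≤ 2 * (2 : ℝ≥0∞) ^ ℓ Q * v Q)
    {e : Set X → ℝ≥0∞} {η : ℤ → ℝ≥0∞} (he : ∀ Q ∈ A, (e Q)⁻¹ ≤ η (ℓ Q)) (R : Set X) :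
    ∑ Q ∈ A.filter (· ⊆ R), σ Q / e Q ≤ 2 * c * (∑' r, η r) * σ R := by
  set A' := A.filter (· ⊆ R) with hA'
  have hA'A : ∀ Q ∈ A', Q ∈ A := fun Q hQ => (Finset.mem_filter.1 hQ).1
  -- At one level, `σ Q` may be exchanged for `2 ^ r * v Q` with loss two. Packing for `v` is
  -- applied under each maximal cube of the level, and these are disjoint subsets of `R`. The
  -- constant level function `0` makes `tops B` the maximal members of `B`.
  have hlevel : ∀ r : ℤ, ∑ Q ∈ A' with ℓ Q = r, σ Q ≤ 2 * c * σ R := by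
    intro r
    set B := A'.filter (fun Q => ℓ Q = r) with hB
    have hBA : B ⊆ A := fun Q hQ => hA'A Q (Finset.mem_filter.1 hQ).1
    have hBl : Laminar B := hA.mono hBA
    have hBr : ∀ Q ∈ B, ℓ Q = r := fun Q hQ => (Finset.mem_filter.1 hQ).2
    have hBR : ∀ Q ∈ B, Q ⊆ R := fun Q hQ =>
      (Finset.mem_filter.1 (Finset.mem_filter.1 hQ).1).2
    have hBne : ∀ Q ∈ B, Q.Nonempty := fun Q hQ => hne Q (hBA hQ)
    set t : Finset (Set X) := tops B (fun _ => 0) with ht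
    have htB : ∀ P ∈ t, P ∈ B := fun P hP => (mem_tops.1 hP).1
    calc ∑ Q ∈ B, σ Q ≤ ∑ Q ∈ B, 2 * (2 : ℝ≥0∞) ^ r * v Q :=
          Finset.sum_le_sum fun Q hQ => hBr Q hQ ▸ (hℓ Q (hBA hQ)).2
      _ = 2 * (2 : ℝ≥0∞) ^ r * ∑ P ∈ t, ∑ Q ∈ B with levelTop B (fun _ => 0) Q = P, v Q := by
          rw [← Finset.mul_sum, Finset.sum_fiberwise_of_maps_to]
          exact fun Q hQ => levelTop_mem_tops hBl hBne (fun _ _ _ _ _ => le_rfl) hQ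
      _ ≤ 2 * (2 : ℝ≥0∞) ^ r * ∑ P ∈ t, c * v P := by
          gcongr with P hP
          refine hpack P (hBA (htB P hP)) _ ((Finset.filter_subset _ _).trans hBA) ?_
          intro Q hQ
          obtain ⟨hQ1, hQ2⟩ := Finset.mem_filter.1 hQ
          rw [← hQ2]
          exact self_subset_levelTop hQ1
      _ = 2 * c * ∑ P ∈ t, (2 : ℝ≥0∞) ^ r * v P := by
          rw [← Finset.mul_sum, ← Finset.mul_sum]; ring
      _ ≤ 2 * c * ∑ P ∈ t, σ P := by
          gcongr with P hP
          exact hBr P (htB P hP) ▸ (hℓ P (hBA (htB P hP))).1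
      _ ≤ 2 * c * σ R := by
          gcongr
          exact sum_tops_measure_le hBl (fun Q hQ => hmeas Q (hBA hQ)) σ hBR
  calc ∑ Q ∈ A', σ Q / e Q ≤ ∑ Q ∈ A', η (ℓ Q) * σ Q := by
        refine Finset.sum_le_sum fun Q hQ => ?_
        rw [div_eq_mul_inv, mul_comm]
        gcongr
        exact he Q (hA'A Q hQ)
    _ = ∑ r ∈ A'.image ℓ, ∑ Q ∈ A' with ℓ Q = r, η (ℓ Q) * σ Q :=
        (Finset.sum_fiberwise_of_maps_to (fun Q hQ => Finset.mem_image_of_mem ℓ hQ) _).symm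
    _ = ∑ r ∈ A'.image ℓ, η r * ∑ Q ∈ A' with ℓ Q = r, σ Q := by
        refine Finset.sum_congr rfl fun r _ => ?_
        rw [Finset.mul_sum]
        refine Finset.sum_congr rfl fun Q hQ => ?_
        rw [(Finset.mem_filter.1 hQ).2]
    _ ≤ ∑ r ∈ A'.image ℓ, η r * (2 * c * σ R) := by
        gcongr with r
        exact hlevel r
    _ = (∑ r ∈ A'.image ℓ, η r) * (2 * c * σ R) := (Finset.sum_mul _ _ _).symm
    _ ≤ (∑' r, η r) * (2 * c * σ R) := by
        gcongr
        exact ENNReal.sum_le_tsum _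
    _ = _ := by ring

/-- The reciprocal of a bump function is dominated by a summable sequence of dyadic levels. -/
theorem IsBumpFunction.exists_level_bound {ε : ℝ → ℝ} (hε : IsBumpFunction ε) :
    ∃ η : ℤ → ℝ≥0∞, ∑' r, η r ≠ ∞ ∧ ∀ (r : ℤ) (t : ℝ), (2 : ℝ) ^ r ≤ t → t ≤ 2 * (2 : ℝ) ^ r →
      (ENNReal.ofReal (ε t))⁻¹ ≤ η r := by
  obtain ⟨⟨c, hc, hcε⟩, hanti, hmono, hsum⟩ := hε
  have hpow : ∀ r : ℤ, (0 : ℝ) < 2 ^ r := fun r => by positivity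
  have hpos : ∀ r : ℤ, 0 < ε ((2 : ℝ) ^ r) := fun r => hc.trans_le (hcε _ (hpow r))
  set a : ℤ → ℝ≥0∞ := fun r => ENNReal.ofReal (ε ((2 : ℝ) ^ r))⁻¹ with ha
  have hasum : ∑' r, a r ≠ ∞ := by
    rw [ha, ← ENNReal.ofReal_tsum_of_nonneg (fun r => (inv_pos.2 (hpos r)).le) hsum]
    exact ENNReal.ofReal_ne_top
  have hinv : ∀ s t : ℝ, 0 < s → s ≤ t → (ENNReal.ofReal t)⁻¹ ≤ ENNReal.ofReal s⁻¹ := by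
    intro s t hs hst
    rw [ENNReal.ofReal_inv_of_pos hs, ENNReal.inv_le_inv]
    exact ENNReal.ofReal_le_ofReal hst
  -- The intervals `[2^r, 2^(r+1)]` with `r = -1, 0` touch the point `1`, where neither monotonicity
  -- hypothesis applies; there only the lower bound `c` is used. Elsewhere `ε` is compared with its
  -- value at the left endpoint (`r > 0`) or the right one (`r < -1`).
  set b : ℤ → ℝ≥0∞ := fun r => if r ∈ ({-1, 0} : Finset ℤ) then ENNReal.ofReal c⁻¹ else 0 with hb
  have hbsum : ∑' r, b r ≠ ∞ := by
    rw [tsum_eq_sum (s := {-1, 0}) fun r hr => if_neg hr]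
    exact ENNReal.sum_ne_top.2 fun r hr => by rw [if_pos hr]; simp
  refine ⟨fun r => a r + a (r + 1) + b r, ?_, ?_⟩
  · rw [ENNReal.tsum_add, ENNReal.tsum_add]
    have hshift : ∑' r, a (r + 1) = ∑' r, a r := (Equiv.addRight (1 : ℤ)).tsum_eq a
    rw [hshift]
    exact ENNReal.add_ne_top.2 ⟨ENNReal.add_ne_top.2 ⟨hasum, hasum⟩, hbsum⟩
  · intro r t hrt htr
    have ht : 0 < t := (hpow r).trans_le hrt
    have htr' : t ≤ (2 : ℝ) ^ (r + 1) := by rwa [zpow_add_one₀ (by norm_num), mul_comm]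
    rcases lt_or_ge 0 r with hr | hr
    · have h1 : (1 : ℝ) < 2 ^ r := one_lt_zpow₀ (by norm_num) hr
      refine le_trans (hinv _ _ (hpos r) (hmono h1 (h1.trans_le hrt) hrt)) ?_
      exact le_add_right le_self_add
    rcases lt_or_ge r (-1) with hr' | hr'
    · have h1 : (2 : ℝ) ^ (r + 1) < 1 := zpow_lt_one_of_neg₀ (by norm_num) (by omega)
      refine le_trans (hinv _ _ (hpos (r + 1))
        (hanti ⟨ht, htr'.trans_lt h1⟩ ⟨hpow _, h1⟩ htr')) ?_
      exact le_add_right le_add_self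
    · have hbr : b r = ENNReal.ofReal c⁻¹ := by
        rw [hb]
        simp only
        rw [if_pos]
        simp only [Finset.mem_insert, Finset.mem_singleton]
        omega
      refine le_trans (hinv _ _ hc (hcε t ht)) ?_
      exact hbr ▸ le_add_self

end Carleson

/-! ### The sparse kernel and the bound for finite subfamilies. -/

section Main

open scoped Classical

variable {d : ℕ}

/-- The coefficient `|Q| ^ (α / d) / |Q|` of the sparse operator. -/
noncomputable def kernelCoeff (α : ℝ) (Q : Set (Fin d → ℝ)) : ℝ≥0∞ :=
  volume Q ^ (α / d) / volume Q

theorem kernelCoeff_eq (α : ℝ) {l : ℝ} {Q : Set (Fin d → ℝ)} (hQ : IsCubeOfSide l Q) :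
    kernelCoeff α Q = (volume Q ^ (1 - α / d))⁻¹ := by
  rw [kernelCoeff, ← ENNReal.rpow_neg, neg_sub,
    ENNReal.rpow_sub _ _ hQ.volume_ne_zero hQ.volume_ne_top, ENNReal.rpow_one]

theorem kernelCoeff_ne_zero (α : ℝ) {l : ℝ} {Q : Set (Fin d → ℝ)} (hQ : IsCubeOfSide l Q) :
    kernelCoeff α Q ≠ 0 := by
  rw [kernelCoeff_eq α hQ, Ne, ENNReal.inv_eq_zero]
  exact ENNReal.rpow_ne_top_of_ne_zero hQ.volume_ne_zero hQ.volume_ne_top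

theorem kernelCoeff_ne_top (α : ℝ) {l : ℝ} {Q : Set (Fin d → ℝ)} (hQ : IsCubeOfSide l Q) :
    kernelCoeff α Q ≠ ∞ := by
  rw [kernelCoeff_eq α hQ, Ne, ENNReal.inv_eq_top]
  exact (ENNReal.rpow_pos (pos_iff_ne_zero.2 hQ.volume_ne_zero) hQ.volume_ne_top).ne'

/-- The coefficient is `|Q|^(-(1 - α/d))` with a positive exponent `1 - α/d`, and a proper subcube
has at most half the volume. -/
theorem kernelCoeff_growth {α : ℝ} (hd : 0 < d) (hα : α < d) {S : Set (Set (Fin d → ℝ))}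
    (hS : IsDyadicFamily S) {Q R : Set (Fin d → ℝ)} (hQ : Q ∈ S) (hR : R ∈ S) (h : Q ⊂ R) :
    ENNReal.ofReal ((2 : ℝ) ^ (1 - α / d)) * kernelCoeff α R ≤ kernelCoeff α Q := by
  obtain ⟨j, hj⟩ := hS.1 Q hQ
  obtain ⟨k, hk⟩ := hS.1 R hR
  have hθ : 0 ≤ 1 - α / d := by
    rw [sub_nonneg, div_le_one (by exact_mod_cast hd)]
    exact hα.le
  have h2 : ENNReal.ofReal ((2 : ℝ) ^ (1 - α / d)) = (2 : ℝ≥0∞) ^ (1 - α / d) := by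
    rw [← ENNReal.ofReal_rpow_of_pos (by norm_num)]
    simp
  have h20 : (2 : ℝ≥0∞) ^ (1 - α / d) ≠ 0 := (ENNReal.rpow_pos (by simp) (by simp)).ne'
  have h2t : (2 : ℝ≥0∞) ^ (1 - α / d) ≠ ∞ := ENNReal.rpow_ne_top_of_nonneg hθ (by simp)
  rw [kernelCoeff_eq α hj, kernelCoeff_eq α hk, h2]
  calc (2 : ℝ≥0∞) ^ (1 - α / d) * (volume R ^ (1 - α / d))⁻¹
      ≤ (2 : ℝ≥0∞) ^ (1 - α / d) * ((2 * volume Q) ^ (1 - α / d))⁻¹ := by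
        gcongr
        exact two_mul_volume_le_of_ssubset hd hS hQ hR h
    _ = _ := by
        rw [ENNReal.mul_rpow_of_nonneg _ _ hθ, ENNReal.mul_inv (Or.inl h20) (Or.inl h2t),
          ← mul_assoc, ENNReal.mul_inv_cancel h20 h2t, one_mul]

theorem apq_eq {α : ℝ} (p q : ℝ) (σ w : (Fin d → ℝ) → ℝ) {l : ℝ} {Q : Set (Fin d → ℝ)}
    (hQ : IsCubeOfSide l Q) :
    apq α p q σ w Q = kernelCoeff α Q *
      (weightMeasure w Q ^ (1 / q) * weightMeasure σ Q ^ (1 / p.conjExponent)) := by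
  rw [apq, kernelCoeff_eq α hQ, ENNReal.div_eq_inv_mul]

theorem IsWeight.integrableOn {u : (Fin d → ℝ) → ℝ} (hu : IsWeight u) {l : ℝ}
    {Q : Set (Fin d → ℝ)} (hQ : IsCubeOfSide l Q) : IntegrableOn u Q volume := by
  obtain ⟨T, hT, hQT⟩ := hQ.subset_isCompact
  exact (hu.1.integrableOn_isCompact hT).mono_set hQT

theorem weightMeasure_apply (u : (Fin d → ℝ) → ℝ) {l : ℝ}
    {Q : Set (Fin d → ℝ)} (hQ : IsCubeOfSide l Q) :
    weightMeasure u Q = ∫⁻ x in Q, ENNReal.ofReal (u x) :=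
  withDensity_apply _ hQ.measurableSet

theorem IsWeight.weightMeasure_ne_top {u : (Fin d → ℝ) → ℝ} (hu : IsWeight u) {l : ℝ}
    {Q : Set (Fin d → ℝ)} (hQ : IsCubeOfSide l Q) : weightMeasure u Q ≠ ∞ := by
  rw [weightMeasure_apply u hQ]
  exact (hu.integrableOn hQ).lintegral_lt_top.ne

theorem IsWeight.average_eq {u : (Fin d → ℝ) → ℝ} (hu : IsWeight u) {l : ℝ}
    {Q : Set (Fin d → ℝ)} (hQ : IsCubeOfSide l Q) :
    ⨍ x in Q, u x = (weightMeasure u Q / volume Q).toReal := by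
  rw [setAverage_eq, integral_eq_lintegral_of_nonneg_ae (ae_restrict_of_ae hu.2)
    (hu.integrableOn hQ).aestronglyMeasurable, ← weightMeasure_apply u hQ, ENNReal.toReal_div,
    smul_eq_mul, Measure.real, inv_mul_eq_div]

/-- The reciprocal bumps of a weight form a Carleson sequence on a sparse family. -/
theorem exists_carleson_const (hd : 0 < d) {lam : ℝ} (hlam : lam < 1) {ε : ℝ → ℝ}
    (hε : IsBumpFunction ε) :
    ∃ Γ : ℝ≥0∞, Γ ≠ ∞ ∧ ∀ S : Set (Set (Fin d → ℝ)), IsSparse lam S →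
      ∀ u : (Fin d → ℝ) → ℝ, IsWeight u → ∀ A : Finset (Set (Fin d → ℝ)),
      (∀ Q ∈ A, Q ∈ S) → (∀ Q ∈ A, weightMeasure u Q ≠ 0) → ∀ R : Set (Fin d → ℝ),
      ∑ Q ∈ A.filter (· ⊆ R), weightMeasure u Q / ENNReal.ofReal (ε (⨍ x in Q, u x)) ≤
        Γ * weightMeasure u R := by
  obtain ⟨η, hη, hle⟩ := hε.exists_level_bound
  have hl1 : ENNReal.ofReal lam < 1 := by
    rw [← ENNReal.ofReal_one]; exact (ENNReal.ofReal_lt_ofReal_iff one_pos).2 hlam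
  refine ⟨2 * (1 - ENNReal.ofReal lam)⁻¹ * ∑' r, η r,
    ENNReal.mul_ne_top (ENNReal.mul_ne_top (by simp) ?_) hη, ?_⟩
  · rw [Ne, ENNReal.inv_eq_top]
    exact (tsub_pos_of_lt hl1).ne'
  intro S hS u hu A hAS hA0 R
  have hcube : ∀ Q ∈ A, ∃ k : ℤ, IsCubeOfSide ((2 : ℝ) ^ k) Q := fun Q hQ => hS.1.1 Q (hAS Q hQ)
  have hint : ∀ Q ∈ A, ∫⁻ x in Q, ENNReal.ofReal (u x) = weightMeasure u Q := by
    intro Q hQ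
    obtain ⟨k, hk⟩ := hcube Q hQ
    exact (weightMeasure_apply u hk).symm
  obtain ⟨ℓ, hℓ⟩ := exists_average_level A volume
    (fun Q hQ => (hcube Q hQ).choose_spec.volume_ne_top) (fun x => ENNReal.ofReal (u x))
    (fun Q hQ => by rw [hint Q hQ]; exact hA0 Q hQ)
    (fun Q hQ => by
      rw [hint Q hQ]; exact hu.weightMeasure_ne_top (hcube Q hQ).choose_spec)
  refine carleson_of_packing (ℓ := ℓ) (v := volume)
    (fun Q hQ P hP => hS.1.2 Q (hAS Q hQ) P (hAS P hP))
    (fun Q hQ => (hcube Q hQ).choose_spec.nonempty)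
    (fun Q hQ => (hcube Q hQ).choose_spec.measurableSet) _ ?_ ?_ ?_ R
  · intro P hP B hBA hBP
    exact hS.packing hd hlam (hAS P hP) B fun Q hQ => ⟨hAS Q (hBA hQ), hBP Q hQ⟩
  · intro Q hQ
    have := hℓ Q hQ
    rwa [hint Q hQ] at this
  · intro Q hQ
    obtain ⟨k, hk⟩ := hcube Q hQ
    have hv0 := hk.volume_ne_zero
    have hvt := hk.volume_ne_top
    obtain ⟨h1, h2⟩ := hℓ Q hQ
    rw [hint Q hQ] at h1 h2
    have hpow : ((2 : ℝ≥0∞) ^ ℓ Q).toReal = (2 : ℝ) ^ ℓ Q := by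
      rw [← ENNReal.rpow_intCast, ← ENNReal.toReal_rpow, ENNReal.toReal_ofNat, Real.rpow_intCast]
    have hpt : (2 : ℝ≥0∞) ^ ℓ Q ≠ ∞ := (ENNReal.zpow_lt_top (by simp) (by simp) _).ne
    rw [hu.average_eq hk]
    refine hle (ℓ Q) _ ?_ ?_
    · rw [← hpow]
      refine ENNReal.toReal_mono (ENNReal.div_ne_top (hu.weightMeasure_ne_top hk) hv0) ?_
      exact (ENNReal.le_div_iff_mul_le (Or.inl hv0) (Or.inl hvt)).2 h1
    · have h3 := ENNReal.toReal_mono (ENNReal.mul_ne_top (by simp) hpt)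
        ((ENNReal.div_le_iff hv0 hvt).2 h2)
      rwa [ENNReal.toReal_mul, hpow, ENNReal.toReal_ofNat] at h3

theorem IsBumpFunction.ofReal_average_ne_zero {ε : ℝ → ℝ} (hε : IsBumpFunction ε)
    {u : (Fin d → ℝ) → ℝ} (hu : IsWeight u) {l : ℝ} {Q : Set (Fin d → ℝ)}
    (hQ : IsCubeOfSide l Q) (h0 : weightMeasure u Q ≠ 0) :
    ENNReal.ofReal (ε (⨍ x in Q, u x)) ≠ 0 := by
  obtain ⟨⟨c, hc, hcε⟩, -⟩ := hε
  have hpos : 0 < ⨍ x in Q, u x := by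
    rw [hu.average_eq hQ]
    exact ENNReal.toReal_pos (ENNReal.div_ne_zero.2 ⟨h0, hQ.volume_ne_top⟩)
      (ENNReal.div_ne_top (hu.weightMeasure_ne_top hQ) hQ.volume_ne_zero)
  exact (ENNReal.ofReal_pos.2 (hc.trans_le (hcε _ hpos))).ne'

theorem setLIntegral_ne_top_of_rpow {X : Type*} [MeasurableSpace X] (μ : Measure X) {p p' : ℝ}
    (hp : p.HolderConjugate p') {f : X → ℝ≥0∞} (hf : Measurable f)
    (hfp : ∫⁻ x, f x ^ p ∂μ ≠ ∞) {Q : Set X} (hQ : μ Q ≠ ∞) : ∫⁻ x in Q, f x ∂μ ≠ ∞ := by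
  have h := ENNReal.lintegral_mul_le_Lp_mul_Lq (μ.restrict Q) hp hf.aemeasurable
    (aemeasurable_const (b := (1 : ℝ≥0∞)))
  simp only [Pi.mul_apply, mul_one, ENNReal.one_rpow, lintegral_const, one_mul,
    Measure.restrict_apply_univ] at h
  refine ne_top_of_le_ne_top (ENNReal.mul_ne_top ?_ ?_) h
  · exact ENNReal.rpow_ne_top_of_nonneg (one_div_nonneg.2 hp.nonneg)
      (ne_top_of_le_ne_top hfp (setLIntegral_le_lintegral _ _))
  · exact ENNReal.rpow_ne_top_of_nonneg (one_div_nonneg.2 hp.symm.nonneg) hQ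

/-- If `∫ T g` is controlled for `g = T ^ (q - 1)`, so is the `L^q` norm of `T`. -/
theorem rpow_one_div_le_of_le_mul {q r : ℝ} (hq : q.HolderConjugate r) {J M : ℝ≥0∞} (hJ : J ≠ ∞)
    (h : J ≤ M * J ^ (1 / r)) : J ^ (1 / q) ≤ M := by
  rcases eq_or_ne J 0 with rfl | h0
  · rw [ENNReal.zero_rpow_of_pos (one_div_pos.2 hq.pos)]
    exact zero_le
  have hr0 : J ^ (1 / r) ≠ 0 := (ENNReal.rpow_pos (pos_iff_ne_zero.2 h0) hJ).ne'
  have hrt : J ^ (1 / r) ≠ ∞ := ENNReal.rpow_ne_top_of_ne_zero h0 hJ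
  have hexp : 1 / q = 1 - 1 / r := by
    have := hq.inv_add_inv_eq_one
    simp only [one_div]
    linarith
  rw [hexp, ENNReal.rpow_sub _ _ h0 hJ, ENNReal.rpow_one]
  exact ENNReal.div_le_of_le_mul h

/-- The weighted bound for finite subfamilies of a sparse family. -/
theorem exists_finite_bound {α p q lam : ℝ} (hd : 0 < d) (hα : α < d)
    (hp : 1 < p) (hpq : p < q) (hlam : lam < 1) {ε : ℝ → ℝ} (hε : IsBumpFunction ε) :
    ∃ C : ℝ≥0, ∀ S : Set (Set (Fin d → ℝ)), IsSparse lam S →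
      ∀ σ w : (Fin d → ℝ) → ℝ, IsWeight σ → IsWeight w →
      ∀ A : Finset (Set (Fin d → ℝ)), (∀ Q ∈ A, Q ∈ S) →
      ∀ f : (Fin d → ℝ) → ℝ≥0∞, Measurable f → ∫⁻ x, f x ^ p ∂weightMeasure σ ≤ 1 →
      (∫⁻ x, (∑ Q ∈ A, Q.indicator
        (fun _ => kernelCoeff α Q * ∫⁻ y in Q, f y ∂weightMeasure σ) x) ^ q
          ∂weightMeasure w) ^ (1 / q) ≤
        C * (bumpD α p q ε σ w + bumpDStar α p q ε σ w) := by
  have hpc : p.HolderConjugate p.conjExponent := Real.HolderConjugate.conjExponent hp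
  have hqc : q.HolderConjugate q.conjExponent := Real.HolderConjugate.conjExponent (hp.trans hpq)
  set p' := p.conjExponent with hp'
  set r := q.conjExponent with hr
  have hp0 := hpc.pos
  have hq0 := hqc.pos
  have hp0' := hpc.symm.pos
  have hr0 := hqc.symm.pos
  have hrp : r < p' := by
    have h1 := hpc.inv_add_inv_eq_one
    have h2 := hqc.inv_add_inv_eq_one
    have h3 : q⁻¹ < p⁻¹ := (inv_lt_inv₀ hq0 hp0).2 hpq
    exact (inv_lt_inv₀ hp0' hr0).1 (by linarith)
  have hρ : (1 : ℝ) < (2 : ℝ) ^ (1 - α / d) := by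
    refine Real.one_lt_rpow (by norm_num) ?_
    rw [sub_pos, div_lt_one (by exact_mod_cast hd)]
    exact hα
  obtain ⟨Γ, hΓt, hΓ⟩ := exists_carleson_const hd hlam hε
  obtain ⟨C₁, hC₁⟩ := exists_testing_const (Fin d → ℝ) hρ hpc hpq
  obtain ⟨C₂, hC₂⟩ := exists_testing_const (Fin d → ℝ) hρ hqc.symm hrp
  set c : ℝ≥0∞ := C₁ * Γ ^ (1 / q) + C₂ * Γ ^ (1 / p') with hc
  have hct : c ≠ ∞ := by
    refine ENNReal.add_ne_top.2 ⟨ENNReal.mul_ne_top (by simp) ?_, ENNReal.mul_ne_top (by simp) ?_⟩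
    · exact ENNReal.rpow_ne_top_of_nonneg (by positivity) hΓt
    · exact ENNReal.rpow_ne_top_of_nonneg (by positivity) hΓt
  set b : ℝ≥0∞ := 4 * c * maxConst p ^ (1 / p) * maxConst r ^ (1 / r) with hb
  have hbt : b ≠ ∞ := by
    refine ENNReal.mul_ne_top (ENNReal.mul_ne_top (ENNReal.mul_ne_top (by simp) hct) ?_) ?_
    · exact ENNReal.rpow_ne_top_of_nonneg (by positivity) (maxConst_ne_top hp)
    · exact ENNReal.rpow_ne_top_of_nonneg (by positivity) (maxConst_ne_top hqc.symm.lt)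
  refine ⟨b.toNNReal, ?_⟩
  rw [ENNReal.coe_toNNReal hbt]
  intro S hS σ w hσ hw A hAS f hf hf1
  set D := bumpD α p q ε σ w
  set E := bumpDStar α p q ε σ w
  have hcube : ∀ Q ∈ A, ∃ k : ℤ, IsCubeOfSide ((2 : ℝ) ^ k) Q := fun Q hQ => hS.1.1 Q (hAS Q hQ)
  have hmeas : ∀ Q ∈ A, MeasurableSet Q := fun Q hQ => (hcube Q hQ).choose_spec.measurableSet
  have hσt : ∀ Q ∈ A, weightMeasure σ Q ≠ ∞ := fun Q hQ =>
    hσ.weightMeasure_ne_top (hcube Q hQ).choose_spec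
  have hwt : ∀ Q ∈ A, weightMeasure w Q ≠ ∞ := fun Q hQ =>
    hw.weightMeasure_ne_top (hcube Q hQ).choose_spec
  set ν : Set (Fin d → ℝ) → ℝ≥0∞ := fun Q => ∫⁻ y in Q, f y ∂weightMeasure σ with hν
  have hνt : ∀ Q ∈ A, ν Q ≠ ∞ := fun Q hQ =>
    setLIntegral_ne_top_of_rpow _ hpc hf (ne_top_of_le_ne_top (by simp) hf1) (hσt Q hQ)
  set T : (Fin d → ℝ) → ℝ≥0∞ := fun x => ∑ Q ∈ A, Q.indicator
    (fun _ => kernelCoeff α Q * ν Q) x with hT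
  have hind : ∀ Q ∈ A, Measurable (Q.indicator (fun _ => kernelCoeff α Q * ν Q)) := fun Q hQ =>
    measurable_const.indicator (hmeas Q hQ)
  have hTm : Measurable T := Finset.measurable_sum _ hind
  -- The extremal dual function: `T * g = T ^ q` and `g ^ r = T ^ q`, so the bilinear bound reads `J
  -- ≤ M * J ^ (1 / r)`. Dividing requires `J` finite, which holds because the family is finite.
  set g : (Fin d → ℝ) → ℝ≥0∞ := fun x => T x ^ (q - 1) with hg
  have hgm : Measurable g := hTm.pow_const _
  set μ : Set (Fin d → ℝ) → ℝ≥0∞ := fun Q => ∫⁻ y in Q, g y ∂weightMeasure w with hμ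
  have hμt : ∀ Q ∈ A, μ Q ≠ ∞ := by
    intro Q hQ
    have hbound : ∀ x, g x ≤ (∑ P ∈ A, kernelCoeff α P * ν P) ^ (q - 1) := by
      intro x
      refine ENNReal.rpow_le_rpow (Finset.sum_le_sum fun P _ => ?_) (by linarith)
      exact Set.indicator_le_self _ _ _
    have h1 : μ Q ≤ (∑ P ∈ A, kernelCoeff α P * ν P) ^ (q - 1) * weightMeasure w Q := by
      refine (lintegral_mono hbound).trans_eq ?_
      simp
    refine ne_top_of_le_ne_top (ENNReal.mul_ne_top (ENNReal.rpow_ne_top_of_nonneg (by linarith)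
      (ENNReal.sum_ne_top.2 fun P hP => ?_)) (hwt Q hQ)) h1
    exact ENNReal.mul_ne_top (kernelCoeff_ne_top α (hcube P hP).choose_spec) (hνt P hP)
  set J := ∫⁻ x, T x ^ q ∂weightMeasure w with hJ
  have hJg : ∫⁻ x, g x ^ r ∂weightMeasure w = J := by
    rw [hJ]
    congr 1
    funext x
    rw [hg]
    simp only
    rw [← ENNReal.rpow_mul, hqc.sub_one_mul_conj]
  have hJsum : J = ∑ Q ∈ A, kernelCoeff α Q * ν Q * μ Q := by
    have h1 : ∀ x, T x ^ q = ∑ Q ∈ A, kernelCoeff α Q * ν Q * Q.indicator g x := by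
      intro x
      calc T x ^ q = T x * g x := by
            rw [hg]
            simp only
            conv_lhs => rw [show q = 1 + (q - 1) by ring]
            rw [ENNReal.rpow_add_of_nonneg _ _ (by norm_num) (by linarith), ENNReal.rpow_one]
        _ = _ := by
            rw [hT]
            simp only
            rw [Finset.sum_mul]
            refine Finset.sum_congr rfl fun Q _ => ?_
            by_cases hx : x ∈ Q <;> simp [hx]
    rw [hJ]
    simp_rw [h1]
    rw [lintegral_finsetSum _ fun Q hQ => (hgm.indicator (hmeas Q hQ)).const_mul _]
    refine Finset.sum_congr rfl fun Q hQ => ?_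
    rw [lintegral_const_mul _ (hgm.indicator (hmeas Q hQ)), lintegral_indicator (hmeas Q hQ)]
  have hJt : J ≠ ∞ := by
    rw [hJsum]
    exact ENNReal.sum_ne_top.2 fun Q hQ => ENNReal.mul_ne_top (ENNReal.mul_ne_top
      (kernelCoeff_ne_top α (hcube Q hQ).choose_spec) (hνt Q hQ)) (hμt Q hQ)
  -- The discarded cubes contribute nothing to the form. On the rest, both averages have a dyadic
  -- level and both weights have positive mass.
  set B := A.filter (fun Q => ν Q ≠ 0 ∧ μ Q ≠ 0) with hB
  have hBA : ∀ Q ∈ B, Q ∈ A := fun Q hQ => (Finset.mem_filter.1 hQ).1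
  have hBν : ∀ Q ∈ B, ν Q ≠ 0 := fun Q hQ => (Finset.mem_filter.1 hQ).2.1
  have hBμ : ∀ Q ∈ B, μ Q ≠ 0 := fun Q hQ => (Finset.mem_filter.1 hQ).2.2
  have hBS : ∀ Q ∈ B, Q ∈ S := fun Q hQ => hAS Q (hBA Q hQ)
  have hBc : ∀ Q ∈ B, ∃ k : ℤ, IsCubeOfSide ((2 : ℝ) ^ k) Q := fun Q hQ => hcube Q (hBA Q hQ)
  have hBl : Laminar B := fun Q hQ R hR => hS.1.2 Q (hBS Q hQ) R (hBS R hR)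
  have hσ0 : ∀ Q ∈ B, weightMeasure σ Q ≠ 0 := fun Q hQ h =>
    hBν Q hQ (setLIntegral_measure_zero _ _ h)
  have hw0 : ∀ Q ∈ B, weightMeasure w Q ≠ 0 := fun Q hQ h =>
    hBμ Q hQ (setLIntegral_measure_zero _ _ h)
  have hJB : J = ∑ Q ∈ B, kernelCoeff α Q * ν Q * μ Q := by
    rw [hJsum, hB, Finset.sum_filter_of_ne]
    intro Q _ h
    constructor <;> intro h' <;> simp [h'] at h
  have htest := hC₁ B hBl (fun Q hQ => hmeas Q (hBA Q hQ)) (weightMeasure σ) (weightMeasure w)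
    hσ0 (fun Q hQ => hσt Q (hBA Q hQ)) (kernelCoeff α)
    (fun Q hQ => kernelCoeff_ne_zero α (hBc Q hQ).choose_spec)
    (fun Q hQ => kernelCoeff_ne_top α (hBc Q hQ).choose_spec)
    (fun Q hQ R hR => kernelCoeff_growth hd hα hS.1 (hBS Q hQ) (hBS R hR))
    (fun Q => ENNReal.ofReal (ε (⨍ x in Q, σ x))) D Γ
    (fun Q hQ => hε.ofReal_average_ne_zero hσ (hBc Q hQ).choose_spec (hσ0 Q hQ))
    (fun _ _ => ENNReal.ofReal_ne_top)
    (fun Q hQ => by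
      obtain ⟨k, hk⟩ := hBc Q hQ
      refine le_trans (le_of_eq ?_) (le_iSup₂_of_le Q ⟨_, hk⟩ le_rfl)
      rw [apq_eq p q σ w hk]
      ring)
    (fun R _ => hΓ S hS σ hσ B hBS hσ0 R)
  -- The dual condition: `σ` and `w` are exchanged and `(p, p', q)` becomes `(r, q, p')`, so the
  -- bump exponent is `1 / p'`.
  have htest' := hC₂ B hBl (fun Q hQ => hmeas Q (hBA Q hQ)) (weightMeasure w) (weightMeasure σ)
    hw0 (fun Q hQ => hwt Q (hBA Q hQ)) (kernelCoeff α)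
    (fun Q hQ => kernelCoeff_ne_zero α (hBc Q hQ).choose_spec)
    (fun Q hQ => kernelCoeff_ne_top α (hBc Q hQ).choose_spec)
    (fun Q hQ R hR => kernelCoeff_growth hd hα hS.1 (hBS Q hQ) (hBS R hR))
    (fun Q => ENNReal.ofReal (ε (⨍ x in Q, w x))) E Γ
    (fun Q hQ => hε.ofReal_average_ne_zero hw (hBc Q hQ).choose_spec (hw0 Q hQ))
    (fun _ _ => ENNReal.ofReal_ne_top)
    (fun Q hQ => by
      obtain ⟨k, hk⟩ := hBc Q hQ
      refine le_trans (le_of_eq ?_) (le_iSup₂_of_le Q ⟨_, hk⟩ le_rfl)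
      rw [apq_eq p q σ w hk]
      ring)
    (fun R _ => hΓ S hS w hw B hBS hw0 R)
  have hbil := bilinear_le hBl (fun Q hQ => (hBc Q hQ).choose_spec.nonempty)
    (fun Q hQ => hmeas Q (hBA Q hQ)) (weightMeasure σ) (weightMeasure w)
    (fun Q hQ => hσt Q (hBA Q hQ)) (fun Q hQ => hwt Q (hBA Q hQ)) hpc hqc hpq.le hrp.le
    (kernelCoeff α) (C₁ * Γ ^ (1 / q) * D) htest (C₂ * Γ ^ (1 / p') * E) htest' hf hgm
    hBν (fun Q hQ => hνt Q (hBA Q hQ)) hBμ (fun Q hQ => hμt Q (hBA Q hQ))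
  refine rpow_one_div_le_of_le_mul hqc hJt ?_
  calc J = ∑ Q ∈ B, kernelCoeff α Q * ν Q * μ Q := hJB
    _ ≤ _ := hbil
    _ ≤ 4 * (c * (D + E)) * (maxConst p * 1) ^ (1 / p) * (maxConst r * J) ^ (1 / r) := by
        rw [hJg]
        gcongr
        calc C₁ * Γ ^ (1 / q) * D + C₂ * Γ ^ (1 / p') * E
            ≤ C₁ * Γ ^ (1 / q) * (D + E) + C₂ * Γ ^ (1 / p') * (D + E) := by
              gcongr
              · exact le_self_add
              · exact le_add_self
          _ = c * (D + E) := by rw [hc, add_mul]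
    _ = _ := by
        rw [mul_one, ENNReal.mul_rpow_of_nonneg _ _ (by positivity : 0 ≤ 1 / r), hb]
        ring

theorem lintegral_tsum_rpow_eq_iSup {X ι : Type*} [MeasurableSpace X] [Countable ι] (μ : Measure X)
    {F : ι → X → ℝ≥0∞} (hF : ∀ i, Measurable (F i)) {q : ℝ} (hq : 0 < q) :
    ∫⁻ x, (∑' i, F i x) ^ q ∂μ = ⨆ s : Finset ι, ∫⁻ x, (∑ i ∈ s, F i x) ^ q ∂μ := by
  rw [← lintegral_iSup_directed]
  · congr 1
    funext x
    rw [ENNReal.tsum_eq_iSup_sum]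
    exact (ENNReal.orderIsoRpow q hq).map_iSup _
  · exact fun s => ((Finset.measurable_sum _ fun i _ => hF i).pow_const _).aemeasurable
  · refine (Monotone.directed_le ?_)
    intro s t hst x
    exact ENNReal.rpow_le_rpow (Finset.sum_le_sum_of_subset hst) hq.le

/-- The density is finite everywhere, so the change of measure needs no measurability of `f`. This
matters because `f` is only measurable up to `σ`-null sets, which may have positive volume where `σ`
vanishes. -/
theorem setLIntegral_enorm_mul_eq {σ : (Fin d → ℝ) → ℝ} (hσ : IsWeight σ)
    (f : (Fin d → ℝ) → ℝ) {Q : Set (Fin d → ℝ)} (hQ : MeasurableSet Q) :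
    ∫⁻ y in Q, ‖σ y * f y‖ₑ = ∫⁻ y in Q, ‖f y‖ₑ ∂weightMeasure σ := by
  have hm : AEMeasurable (fun x => ENNReal.ofReal (σ x)) (volume.restrict Q) :=
    hσ.1.aestronglyMeasurable.aemeasurable.ennreal_ofReal.restrict
  rw [weightMeasure, setLIntegral_withDensity_eq_setLIntegral_mul_non_measurable₀ _ hm _ hQ
    (Filter.Eventually.of_forall fun _ => ENNReal.ofReal_lt_top)]
  refine lintegral_congr_ae ?_
  filter_upwards [ae_restrict_of_ae hσ.2] with x hx
  rw [enorm_mul, Pi.mul_apply, Real.enorm_of_nonneg hx]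

end Main

end SparseBump

/-! ### Passage from finite subfamilies to the full operator. -/

theorem theorem1p2 (d : ℕ) (α p q lam : ℝ) (hα₀ : 0 ≤ α) (hα : α < d)
    (hp : 1 < p) (hpq : p < q) (hlam₀ : 0 < lam) (hlam : lam < 1)
    (ε : ℝ → ℝ) (hε : SparseBump.IsBumpFunction ε) :
    ∃ C : ℝ≥0, ∀ S : Set (Set (Fin d → ℝ)), SparseBump.IsSparse lam S →
      ∀ σ w : (Fin d → ℝ) → ℝ, SparseBump.IsWeight σ → SparseBump.IsWeight w →
        SparseBump.sparseOpNorm α p q S σ w ≤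
          C * (SparseBump.bumpD α p q ε σ w + SparseBump.bumpDStar α p q ε σ w) := by
  classical
  have hd : 0 < d := by exact_mod_cast hα₀.trans_lt hα
  have hp0 : 0 < p := by linarith
  have hq0 : 0 < q := by linarith
  obtain ⟨C, hC⟩ := SparseBump.exists_finite_bound hd hα hp hpq hlam hε
  refine ⟨C, fun S hS σ w hσ hw => ?_⟩
  refine iSup_le fun f => iSup_le fun hf => iSup_le fun hf1 => ?_
  -- A measurable representative of `|f|`; the operator sees `f` only through integrals against `σ`,
  -- so it is unchanged.
  set F : (Fin d → ℝ) → ℝ≥0∞ := fun x => ‖hf.1.mk f x‖ₑ with hF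
  have hFm : Measurable F := hf.1.stronglyMeasurable_mk.measurable.enorm
  have hFf : (fun x => ‖f x‖ₑ) =ᵐ[SparseBump.weightMeasure σ] F := by
    filter_upwards [hf.1.ae_eq_mk] with x hx
    rw [hF, hx]
  have hF1 : ∫⁻ x, F x ^ p ∂SparseBump.weightMeasure σ ≤ 1 := by
    rw [eLpNorm_eq_lintegral_rpow_enorm_toReal (by simpa using hp0) (by simp),
      ENNReal.toReal_ofReal hp0.le] at hf1
    have h1 := ENNReal.rpow_le_rpow hf1 hp0.le
    rw [← ENNReal.rpow_mul, one_div_mul_cancel hp0.ne', ENNReal.rpow_one,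
      ENNReal.one_rpow] at h1
    refine le_of_eq_of_le (lintegral_congr_ae ?_) h1
    filter_upwards [hFf] with x hx
    rw [hx]
  have hcube : ∀ Q : S, ∃ k : ℤ, SparseBump.IsCubeOfSide ((2 : ℝ) ^ k) (Q : Set (Fin d → ℝ)) :=
    fun Q => hS.1.1 Q Q.2
  set G : S → (Fin d → ℝ) → ℝ≥0∞ := fun Q => (Q : Set (Fin d → ℝ)).indicator
    (fun _ => SparseBump.kernelCoeff α (Q : Set (Fin d → ℝ)) *
      ∫⁻ y in (Q : Set (Fin d → ℝ)), F y ∂SparseBump.weightMeasure σ) with hG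
  have hGm : ∀ Q, Measurable (G Q) := fun Q =>
    measurable_const.indicator (hcube Q).choose_spec.measurableSet
  have hop : ∀ x, SparseBump.sparseOp α S (fun x => σ x * f x) x = ∑' Q : S, G Q x := by
    intro x
    refine tsum_congr fun Q => ?_
    rw [hG, SparseBump.setLIntegral_enorm_mul_eq hσ f (hcube Q).choose_spec.measurableSet,
      lintegral_congr_ae (ae_restrict_of_ae hFf)]
    simp only [SparseBump.kernelCoeff, ENNReal.div_eq_inv_mul]
    congr 1
    funext _
    ring
  have : Countable S := hS.1.countable.to_subtype
  rw [eLpNorm_eq_lintegral_rpow_enorm_toReal (by simpa using hq0) (by simp),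
    ENNReal.toReal_ofReal hq0.le]
  simp only [enorm_eq_self, hop]
  -- Monotone convergence over the countable family reduces the claim to finite subfamilies, for
  -- which the constant is uniform.
  rw [SparseBump.lintegral_tsum_rpow_eq_iSup _ hGm hq0, one_div,
    ENNReal.rpow_inv_le_iff hq0]
  refine iSup_le fun s => ?_
  rw [← ENNReal.rpow_inv_le_iff hq0, ← one_div]
  have h := hC S hS σ w hσ hw (s.image (fun Q : S => (Q : Set (Fin d → ℝ))))
    (fun Q hQ => by obtain ⟨P, -, rfl⟩ := Finset.mem_image.1 hQ; exact P.2) F hFm hF1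
  simp_rw [Finset.sum_image (fun a _ b _ h => Subtype.ext h : Set.InjOn
    (fun Q : S => (Q : Set (Fin d → ℝ))) s)] at h
  exact h
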